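/- **Proposition.** For every constant $s<1$ there is a constant $s'\in[0,1)$, depending only on $s$, such that the following holds for each of the three notions perfect, statistical and computational zero knowledge. Let $P=(Q,V)$ be a two-prover one-round $\mathsf{MIP}^*$ protocol for a language $L$ with completeness $1$, soundness $s$, question length at most $q(n)$, answer length at most $a(n)$ ($n$ the input length), messages of polynomial length, and polynomial-time sampling and verification. Suppose that $P$ is perfect (resp. statistical, computational) zero-knowledge against *dishonest* verifiers, and that the perfect strategies witnessing completeness and zero knowledge are projective, commuting and consistent (PCC). Then the oracularized protocol $P^{\mathrm{OR}}=(Q^{\mathrm{OR}},V^{\mathrm{OR}})$ is a protocol for $L$ with completeness $1$, soundness $s'$, question length at most $3q(n)+2$, answer length at most $3a(n)+2$, messages of polynomial length and polynomial-time sampling and verification, and it is perfect (resp. statistical, computational) zero-knowledge against *honest* verifiers, again witnessed by perfect PCC strategies. Here: * *Protocols and strategies.* On input $w$ the protocol is a nonlocal game $G_w=(\mathcal X,\mathcal Y,\mathcal A,\mathcal B,\mu,V)$ whose questions and answers are written as bit strings. Its strategies are finite-dimensional tensor-product strategies $(|\psi\rangle,A,B)$ with projective measurements; on questions $(x,y)$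 they give the answer distribution $P(a,b\mid x,y)=\langle\psi|A^x_a\otimes B^y_b|\psi\rangle$. Completeness $1$: for $w\in L$ some strategy wins with probability $1$. Soundness $s$: for $w\notin L$ no strategy wins with probability larger than $s$. The verifier samples $\mu$ in probabilistic polynomial time, and in deterministic polynomial time checks that the strings received are answers and evaluates $V$. * *PCC.* Both players' operators act on the same space, $A^x_aB^y_b=B^y_bA^x_a$ whenever $\mu(x,y)>0$, and $A^x_a\otimes 1|\psi\rangle=1\otimes A^x_a|\psi\rangle$, $B^y_b\otimes1|\psi\rangle=1\otimes B^y_b|\psi\rangle$ for all $x,a,y,b$. * *Zero knowledge.* There are perfect strategies, one for each $w\in L$, and one probabilistic polynomial-time simulator that, given $w\in L$ and a question pair $(x,y)$, outputs a pair of answers whose distribution equals $P(\cdot,\cdot\mid x,y)$ (perfect); or is at statistical distance from it smaller than any inverse polynomial in $|w|$ (statistical); or cannot be distinguished from it, with advantage larger than an inverse polynomial in $|w|$, by any probabilistic polynomial-time distinguisher that is given $w,x,y$ and the answers (computational). The last two bounds are for $|w|$ large enough, uniformly in $(x,y)$. Against dishonest verifiers this is required for all $(x,y)\in\mathcal X\times\mathcal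 Y$; against honest verifiers only for $(x,y)$ in the support of $\mu$. Probabilistic algorithms may roll fair dice with polynomially many sides. * *Oracularization.* In $G^{\mathrm{OR}}$, the verifier draws $(x,y)\sim\mu$ and, independently, a uniformly random edge of the graph on the roles $\{\mathrm{ORACLE},A,B\}$ with edges $\{\mathrm{ORACLE},A\}$, $\{\mathrm{ORACLE},B\}$ and the three self-loops, and gives the ends of the edge to the two players in random order. A player with role $\mathrm{ORACLE}$ receives $(x,y)$ and must answer with a pair $(a,b)$; with role $A$ receives $x$ and must answer with $a\in\mathcal A$; with role $B$ receives $y$ and must answer with $b\in\mathcal B$. The players win if every oracle's answer satisfies $V(x,y,a,b)=1$ and the answers are consistent: equal when the roles are equal, and otherwise the isolated player's answer equals the corresponding component of the oracle's answer. Questions and answers of $P^{\mathrm{OR}}$ are written as strings that carry a tag for their form, with a self-delimiting encoding of pairs of strings $(u,v)$ of length $2|u|+1+|v|$. -/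

import Mathlib

open scoped Kronecker Matrix

namespace ZKOR

open scoped ComplexOrder

/-! ## Polynomial-time computation

The machine works on binary trees. A program is built from the primitive tree operations by
pairing, composition, branching and `while` loops. Every operation is charged the number of
nodes of the tree on which it acts, so that nothing can be built, copied or inspected for free;
this cost is polynomially related to the number of steps of a Turing machine. -/

/-- Binary trees, the data of the machine. -/
inductive Tr : Type
  | leaf : Tr
  | node : Tr → Tr → Tr

/-- Number of nodes, leaves included. -/
def Tr.size : Tr → ℕ
  | .leaf => 1
  | .node l r => 1 + l.size + r.size

/-- Left subtree (a leaf for a leaf). -/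
def Tr.left : Tr → Tr
  | .leaf => .leaf
  | .node l _ => l

/-- Right subtree (a leaf for a leaf). -/
def Tr.right : Tr → Tr
  | .leaf => .leaf
  | .node _ r => r

/-- Programs. -/
inductive Code : Type
  /-- return the input -/
  | id : Code
  /-- return a leaf -/
  | leaf : Code
  /-- return the left subtree -/
  | left : Code
  /-- return the right subtree -/
  | right : Code
  /-- run both programs on the input and return the tree with the two results as subtrees -/
  | pair : Code → Code → Code
  /-- `comp g f`: run `f`, then run `g` on the result -/
  | comp : Code → Code → Code
  /-- `branch f g`: run `f` if the left subtree of the input is a leaf, and `g` otherwise -/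
  | branch : Code → Code → Code
  /-- `loop f`: while the left subtree of the current tree is not a leaf, apply `f` to it -/
  | loop : Code → Code

/-- `Eval c x y t`: the program `c` on input `x` halts with output `y` after `t` steps. -/
inductive Eval : Code → Tr → Tr → ℕ → Prop
  | id (x : Tr) : Eval .id x x x.size
  | leaf (x : Tr) : Eval .leaf x .leaf x.size
  | left (x : Tr) : Eval .left x x.left x.size
  | right (x : Tr) : Eval .right x x.right x.size
  | pair {f g : Code} {x y z : Tr} {s t : ℕ} :
      Eval f x y s → Eval g x z t → Eval (.pair f g) x (.node y z) (s + t + 1)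
  | comp {f g : Code} {x y z : Tr} {s t : ℕ} :
      Eval f x y s → Eval g y z t → Eval (.comp g f) x z (s + t + 1)
  | branch_leaf {f g : Code} {x y : Tr} {t : ℕ} :
      x.left = .leaf → Eval f x y t → Eval (.branch f g) x y (x.size + t)
  | branch_node {f g : Code} {x y : Tr} {t : ℕ} :
      x.left ≠ .leaf → Eval g x y t → Eval (.branch f g) x y (x.size + t)
  | loop_stop {f : Code} {x : Tr} : x.left = .leaf → Eval (.loop f) x x x.size
  | loop_step {f : Code} {x y z : Tr} {s t : ℕ} :
      x.left ≠ .leaf → Eval f x y s → Eval (.loop f) y z t → Eval (.loop f) x z (x.size + s + t)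

/-- Types whose elements are written as trees. -/
class Coded (α : Type) where
  /-- the tree that represents an element -/
  toTr : α → Tr

instance : Coded Bool where
  toTr b := if b then .node .leaf .leaf else .leaf

/-- Natural numbers are written in unary. -/
def unaryTr : ℕ → Tr
  | 0 => .leaf
  | n + 1 => .node .leaf (unaryTr n)

instance : Coded ℕ where
  toTr := unaryTr

/-- Lists are written as right combs. -/
def listTr {α : Type} [Coded α] : List α → Tr
  | [] => .leaf
  | a :: l => .node (Coded.toTr a) (listTr l)

instance {α : Type} [Coded α] : Coded (List α) where
  toTr := listTr

instance {α β : Type} [Coded α] [Coded β] : Coded (α × β) where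
  toTr p := .node (Coded.toTr p.1) (Coded.toTr p.2)

/-- The total function `f` is computed by a program within a number of steps that is polynomial
in the size of the input. -/
def PolyTime {α β : Type} [Coded α] [Coded β] (f : α → β) : Prop :=
  ∃ (c : Code) (p : Polynomial ℕ), ∀ x : α, ∃ t : ℕ,
    t ≤ p.eval (Coded.toTr x).size ∧ Eval c (Coded.toTr x) (Coded.toTr (f x)) t

/-- Bit strings. -/
abbrev Str : Type := List Bool

/-- `dice [k₁, …, kₘ]` is a list of independent uniform random numbers, the `i`-th one from
`{0, …, kᵢ}`. Fair coins are the case `kᵢ = 1`. -/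
noncomputable def dice : List ℕ → PMF (List ℕ)
  | [] => PMF.pure []
  | k :: ks => (PMF.uniformOfFintype (Fin (k + 1))).bind fun d =>
      (dice ks).map fun r => (d : ℕ) :: r

/-- Probabilistic polynomial-time algorithms: the algorithm determines from its input which dice
to roll (numbers are written in unary, so there are polynomially many dice with polynomially many
sides), and computes its output from the input and the numbers rolled. -/
structure RandAlg (α β : Type) [Coded α] [Coded β] where
  sides : α → List ℕ
  run : α × List ℕ → β
  sides_poly : PolyTime sides
  run_poly : PolyTime run

/-- The output distribution of a probabilistic algorithm. -/
noncomputable def RandAlg.dist {α β : Type} [Coded α] [Coded β] (M : RandAlg α β) (x : α) :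
    PMF β :=
  (dice (M.sides x)).map fun r => M.run (x, r)

/-! ## Nonlocal games and quantum strategies -/

/-- Two-player one-round games. -/
structure Game where
  /-- questions to Alice -/
  X : Type
  /-- questions to Bob -/
  Y : Type
  /-- answers of Alice -/
  A : Type
  /-- answers of Bob -/
  B : Type
  [fintypeX : Fintype X]
  [fintypeY : Fintype Y]
  [fintypeA : Fintype A]
  [fintypeB : Fintype B]
  [decEqA : DecidableEq A]
  [decEqB : DecidableEq B]
  [nonemptyA : Nonempty A]
  [nonemptyB : Nonempty B]
  /-- the question distribution -/
  μ : PMF (X × Y)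
  /-- the decision predicate -/
  V : X → Y → A → B → Bool

attribute [instance] Game.fintypeX Game.fintypeY Game.fintypeA Game.fintypeB Game.decEqA
  Game.decEqB Game.nonemptyA Game.nonemptyB

/-- Tensor-product strategies on `ℂᵐ ⊗ ℂⁿ`: a unit vector, and a projective measurement of each
player for each question. -/
structure Strategy (G : Game) (m n : ℕ) where
  ψ : Fin m × Fin n → ℂ
  ψ_unit : star ψ ⬝ᵥ ψ = 1
  MA : G.X → G.A → Matrix (Fin m) (Fin m) ℂ
  MB : G.Y → G.B → Matrix (Fin n) (Fin n) ℂ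
  MA_proj : ∀ x a, IsStarProjection (MA x a)
  MB_proj : ∀ y b, IsStarProjection (MB y b)
  MA_sum : ∀ x, ∑ a, MA x a = 1
  MB_sum : ∀ y, ∑ b, MB y b = 1

namespace Strategy

variable {G : Game} {m n : ℕ}

/-- The probability `⟨ψ| A^x_a ⊗ B^y_b |ψ⟩` of the answers `a, b` to the questions `x, y`. -/
noncomputable def prob (S : Strategy G m n) (x : G.X) (y : G.Y) (a : G.A) (b : G.B) : ℝ :=
  (star S.ψ ⬝ᵥ ((S.MA x a ⊗ₖ S.MB y b) *ᵥ S.ψ)).re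

theorem prob_nonneg (S : Strategy G m n) (x : G.X) (y : G.Y) (a : G.A) (b : G.B) :
    0 ≤ S.prob x y a b := by
  set K := S.MA x a ⊗ₖ S.MB y b with hK
  have h1 : Kᴴ = K := by
    rw [hK, Matrix.conjTranspose_kronecker]
    congr 1
    · exact (S.MA_proj x a).isSelfAdjoint
    · exact (S.MB_proj y b).isSelfAdjoint
  have h2 : K * K = K := by
    rw [hK, ← Matrix.mul_kronecker_mul]
    congr 1
    · exact (S.MA_proj x a).isIdempotentElem
    · exact (S.MB_proj y b).isIdempotentElem
  have h3 : Matrix.PosSemidef K := by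
    have := Matrix.posSemidef_conjTranspose_mul_self K
    rwa [h1, h2] at this
  have h4 := h3.dotProduct_mulVec_nonneg S.ψ
  exact (Complex.le_def.1 h4).1

theorem sum_prob (S : Strategy G m n) (x : G.X) (y : G.Y) :
    ∑ p : G.A × G.B, S.prob x y p.1 p.2 = 1 := by
  have h : ∑ p : G.A × G.B, S.MA x p.1 ⊗ₖ S.MB y p.2 = 1 := by
    ext ⟨i, j⟩ ⟨k, l⟩
    have hA := congrFun (congrFun (S.MA_sum x) i) k
    have hB := congrFun (congrFun (S.MB_sum y) j) l
    rw [Matrix.sum_apply] at hA hB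
    simp only [Matrix.sum_apply, Matrix.kroneckerMap_apply, Fintype.sum_prod_type]
    rw [← Finset.sum_mul_sum, hA, hB]
    simp only [Matrix.one_apply, Prod.mk.injEq]
    split_ifs <;> simp_all
  unfold prob
  rw [← Complex.re_sum, ← dotProduct_sum, ← Matrix.sum_mulVec, h, Matrix.one_mulVec, S.ψ_unit]
  rfl

/-- The correlation of a strategy: the distribution of the answers to the questions `x, y`. -/
noncomputable def corr (S : Strategy G m n) (x : G.X) (y : G.Y) : PMF (G.A × G.B) :=
  PMF.ofFintype (fun p => ENNReal.ofReal (S.prob x y p.1 p.2)) (by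
    rw [← ENNReal.ofReal_sum_of_nonneg (fun p _ => S.prob_nonneg x y p.1 p.2), S.sum_prob,
      ENNReal.ofReal_one])

/-- The winning probability of a strategy. -/
noncomputable def value (S : Strategy G m n) : ℝ :=
  ∑ x, ∑ y, ∑ a, ∑ b, (G.μ (x, y)).toReal * (if G.V x y a b then 1 else 0) * S.prob x y a b

/-- Projective, commuting and consistent strategies (both players act on copies of the same
space). -/
structure IsPCC (S : Strategy G m m) : Prop where
  comm : ∀ x y, G.μ (x, y) ≠ 0 → ∀ a b, S.MA x a * S.MB y b = S.MB y b * S.MA x a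
  consA : ∀ x a, (S.MA x a ⊗ₖ (1 : Matrix (Fin m) (Fin m) ℂ)) *ᵥ S.ψ =
    ((1 : Matrix (Fin m) (Fin m) ℂ) ⊗ₖ S.MA x a) *ᵥ S.ψ
  consB : ∀ y b, (S.MB y b ⊗ₖ (1 : Matrix (Fin m) (Fin m) ℂ)) *ᵥ S.ψ =
    ((1 : Matrix (Fin m) (Fin m) ℂ) ⊗ₖ S.MB y b) *ᵥ S.ψ

end Strategy

/-! ## Two-prover one-round protocols -/

/-- A protocol: a game for every input, with the questions and answers written as bit strings. -/
structure Protocol where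
  game : Str → Game
  encX : ∀ w, (game w).X ↪ Str
  encY : ∀ w, (game w).Y ↪ Str
  encA : ∀ w, (game w).A ↪ Str
  encB : ∀ w, (game w).B ↪ Str

namespace Protocol

/-- The questions have length at most `q(n)` and the answers have length at most `a(n)`, where
`n` is the length of the input. -/
structure HasLengths (P : Protocol) (q a : ℕ → ℕ) : Prop where
  lenX : ∀ w x, (P.encX w x).length ≤ q w.length
  lenY : ∀ w y, (P.encY w y).length ≤ q w.length
  lenA : ∀ w c, (P.encA w c).length ≤ a w.length
  lenB : ∀ w c, (P.encB w c).length ≤ a w.length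

/-- The verifier runs in polynomial time: the messages have polynomial length, the questions are
sampled by a probabilistic polynomial-time algorithm, and the answers are verified (first that the
strings received are answers at all, then that they win) by deterministic polynomial-time
algorithms. -/
structure IsEfficient (P : Protocol) : Prop where
  polyLengths : ∃ p : Polynomial ℕ, P.HasLengths p.eval p.eval
  sampler : ∃ Q : RandAlg Str (Str × Str), ∀ w,
    Q.dist w = (P.game w).μ.map fun z => (P.encX w z.1, P.encY w z.2)
  answersA : ∃ f : Str × Str → Bool, PolyTime f ∧ ∀ w s, f (w, s) = true ↔ ∃ a, P.encA w a = s
  answersB : ∃ f : Str × Str → Bool, PolyTime f ∧ ∀ w s, f (w, s) = true ↔ ∃ b, P.encB w b = s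
  verifier : ∃ f : Str × Str × Str × Str × Str → Bool, PolyTime f ∧ ∀ w x y a b,
    f (w, P.encX w x, P.encY w y, P.encA w a, P.encB w b) = (P.game w).V x y a b

/-- No strategy wins with probability larger than `s` on inputs outside `L`. -/
def IsSound (P : Protocol) (L : Set Str) (s : ℝ) : Prop :=
  ∀ w, w ∉ L → ∀ (m n : ℕ) (S : Strategy (P.game w) m n), S.value ≤ s

/-- A choice of a strategy for each input in the language. -/
def Provers (P : Protocol) (L : Set Str) : Type :=
  ∀ w, w ∈ L → (d : ℕ) × Strategy (P.game w) d d

/-- The distribution of the answer strings of the provers to the questions `x, y`. -/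
noncomputable def answers (P : Protocol) {L : Set Str} (S : P.Provers L) (w : Str) (hw : w ∈ L)
    (x : (P.game w).X) (y : (P.game w).Y) : PMF (Str × Str) :=
  ((S w hw).2.corr x y).map fun c => (P.encA w c.1, P.encB w c.2)

end Protocol

/-! ## Zero knowledge -/

/-- Honest verifiers ask only question pairs in the support of the question distribution, and
dishonest verifiers may ask any pair of questions. -/
inductive Verifiers : Type
  | honest : Verifiers
  | dishonest : Verifiers

/-- The question pairs that the verifier may ask. -/
def Game.Asked (G : Game) : Verifiers → G.X → G.Y → Prop
  | .honest, x, y => G.μ (x, y) ≠ 0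
  | .dishonest, _, _ => True

/-- The flavours of zero knowledge. -/
inductive Flavour : Type
  | perfect : Flavour
  | statistical : Flavour
  | computational : Flavour

/-- Statistical distance. -/
noncomputable def statDist {α : Type} (p q : PMF α) : ℝ :=
  (1 / 2) * ∑' z, |(p z).toReal - (q z).toReal|

/-- The probability that the distinguisher `D`, which knows the input and the questions, outputs
`true` on answers drawn from `p`. -/
noncomputable def acceptProb (D : RandAlg (Str × Str × Str × Str × Str) Bool) (w x y : Str)
    (p : PMF (Str × Str)) : ℝ :=
  ((p.bind fun c => D.dist (w, x, y, c.1, c.2)) true).toReal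

/-- One probabilistic polynomial-time simulator, given an input in `L` and a question pair that the
verifier may ask, reproduces the distribution of the provers' answers: exactly, or up to a
statistical distance below any inverse polynomial in the input length, or such that the advantage
of every probabilistic polynomial-time distinguisher is below any inverse polynomial. -/
def Protocol.ZeroKnowledge (P : Protocol) (L : Set Str) (v : Verifiers) (S : P.Provers L) :
    Flavour → Prop
  | .perfect => ∃ Sim : RandAlg (Str × Str × Str) (Str × Str),
      ∀ w (hw : w ∈ L) x y, (P.game w).Asked v x y →
        Sim.dist (w, P.encX w x, P.encY w y) = P.answers S w hw x y
  | .statistical => ∃ Sim : RandAlg (Str × Str × Str) (Str × Str),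
      ∀ c : ℕ, ∃ N : ℕ, ∀ w (hw : w ∈ L) x y, N ≤ w.length → (P.game w).Asked v x y →
        statDist (Sim.dist (w, P.encX w x, P.encY w y)) (P.answers S w hw x y) ≤
          1 / ((w.length : ℝ) + 1) ^ c
  | .computational => ∃ Sim : RandAlg (Str × Str × Str) (Str × Str),
      ∀ (D : RandAlg (Str × Str × Str × Str × Str) Bool) (c : ℕ), ∃ N : ℕ,
        ∀ w (hw : w ∈ L) x y, N ≤ w.length → (P.game w).Asked v x y →
          |acceptProb D w (P.encX w x) (P.encY w y) (Sim.dist (w, P.encX w x, P.encY w y)) -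
            acceptProb D w (P.encX w x) (P.encY w y) (P.answers S w hw x y)| ≤
              1 / ((w.length : ℝ) + 1) ^ c

/-- `P` is a zero-knowledge `MIP*` protocol for `L` with completeness `1`, soundness `s`, question
length `q`, answer length `a` and polynomial sampling and verification time. The perfect strategies
that witness completeness and zero knowledge are projective, commuting and consistent. -/
structure Protocol.IsZKMIPStar (P : Protocol) (L : Set Str) (s : ℝ) (q a : ℕ → ℕ)
    (k : Flavour) (v : Verifiers) : Prop where
  lengths : P.HasLengths q a
  efficient : P.IsEfficient
  sound : P.IsSound L s
  complete_zk : ∃ S : P.Provers L,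
    (∀ w hw, (S w hw).2.value = 1 ∧ (S w hw).2.IsPCC) ∧ P.ZeroKnowledge L v S k

/-! ## Oracularization -/

/-- The roles of the players. -/
inductive Role : Type
  | oracle : Role
  | alice : Role
  | bob : Role

/-- The edges of the type graph: the three self-loops, and the edges that link `oracle` with
`alice` and with `bob`. -/
def edges : Fin 5 → Role × Role :=
  ![(.oracle, .oracle), (.alice, .alice), (.bob, .bob), (.oracle, .alice), (.oracle, .bob)]

/-- Questions of the oracularized game: an oracle question `(x, y)`, a question `x` with the role of
Alice, or a question `y` with the role of Bob. -/
abbrev ORQuestion (G : Game) : Type := (G.X × G.Y) ⊕ G.X ⊕ G.Y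

/-- Answers of the oracularized game: a pair `(a, b)`, a single `a`, or a single `b`. -/
abbrev ORAnswer (G : Game) : Type := (G.A × G.B) ⊕ G.A ⊕ G.B

/-- The question that a player with a given role receives when `(x, y)` is drawn. -/
def roleQuestion (G : Game) (z : G.X × G.Y) : Role → ORQuestion G
  | .oracle => .inl z
  | .alice => .inr (.inl z.1)
  | .bob => .inr (.inr z.2)

/-- Draw `(x, y)` from the question distribution, and independently a uniformly random edge of the
type graph, whose two ends are given to the two players in random order. -/
noncomputable def orDist (G : Game) : PMF (ORQuestion G × ORQuestion G) :=
  G.μ.bind fun z => (PMF.uniformOfFintype (Fin 5)).bind fun e =>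
    (PMF.uniformOfFintype Bool).map fun swap =>
      if swap then (roleQuestion G z (edges e).2, roleQuestion G z (edges e).1)
      else (roleQuestion G z (edges e).1, roleQuestion G z (edges e).2)

/-- The decision predicate of the oracularized game: answers must have the form that the role
requires, an oracle's answer must win `G`, and the answers must be consistent. -/
def orPred (G : Game) : ORQuestion G → ORQuestion G → ORAnswer G → ORAnswer G → Bool
  | .inl (x, y), .inl _, .inl (a, b), .inl (a', b') =>
      G.V x y a b && decide (a = a') && decide (b = b')
  | .inl (x, y), .inr (.inl _), .inl (a, b), .inr (.inl a') => G.V x y a b && decide (a = a')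
  | .inr (.inl _), .inl (x, y), .inr (.inl a'), .inl (a, b) => G.V x y a b && decide (a = a')
  | .inl (x, y), .inr (.inr _), .inl (a, b), .inr (.inr b') => G.V x y a b && decide (b = b')
  | .inr (.inr _), .inl (x, y), .inr (.inr b'), .inl (a, b) => G.V x y a b && decide (b = b')
  | .inr (.inl _), .inr (.inl _), .inr (.inl a), .inr (.inl a') => decide (a = a')
  | .inr (.inr _), .inr (.inr _), .inr (.inr b), .inr (.inr b') => decide (b = b')
  | _, _, _, _ => false

/-- The oracularized game. -/
noncomputable def Game.oracularize (G : Game) : Game where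
  X := ORQuestion G
  Y := ORQuestion G
  A := ORAnswer G
  B := ORAnswer G
  μ := orDist G
  V := orPred G

/-- Self-delimiting encoding of a pair of bit strings, of length `2|s| + 1 + |t|`. -/
def pairStr : Str → Str → Str
  | [], t => false :: t
  | b :: s, t => true :: b :: pairStr s t

theorem pairStr_inj : ∀ {s s' t t' : Str}, pairStr s t = pairStr s' t' → s = s' ∧ t = t'
  | [], [], _, _, h => by simpa [pairStr] using h
  | [], _ :: _, _, _, h => by simp [pairStr] at h
  | _ :: _, [], _, _, h => by simp [pairStr] at h
  | b :: s, b' :: s', t, t', h => by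
      simp only [pairStr, List.cons.injEq, true_and] at h
      obtain ⟨h1, h2⟩ := pairStr_inj h.2
      simp [h.1, h1, h2]

/-- Encoding of pairs, left elements and right elements by a tagged bit string. -/
def sumStr {U W : Type} (f : U ↪ Str) (g : W ↪ Str) : (U × W) ⊕ U ⊕ W ↪ Str where
  toFun
    | .inl (u, v) => false :: pairStr (f u) (g v)
    | .inr (.inl u) => true :: false :: f u
    | .inr (.inr v) => true :: true :: g v
  inj' := by
    rintro (⟨u, v⟩ | u | v) (⟨u', v'⟩ | u' | v') h
    · simp only [List.cons.injEq, true_and] at h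
      obtain ⟨h1, h2⟩ := pairStr_inj h
      simp [f.injective h1, g.injective h2]
    all_goals simp_all

/-- The oracularized protocol. -/
noncomputable def Protocol.oracularize (P : Protocol) : Protocol where
  game w := (P.game w).oracularize
  encX w := sumStr (P.encX w) (P.encY w)
  encY w := sumStr (P.encX w) (P.encY w)
  encA w := sumStr (P.encA w) (P.encB w)
  encB w := sumStr (P.encA w) (P.encB w)

end ZKOR

set_option linter.unusedSectionVars false

namespace ZKOR

/-! ## Closure properties of polynomial-time functions -/

/-! Soundness. Given a strategy for the oracularized game, let the two players of `G` act as its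
isolated players (`Strategy.isolated`). If on a drawn pair `(x, y)` the tests (A, A), (oracle, A)
and (oracle, B) each fail with probability at most `δ`, then on the state the first player's
isolated `A` is close to the second player's, which is close to the first component of the oracle's
answer; likewise `B` is close to its second component. The oracle's measurement is the product of
its two marginals, so it is close to `A ⊗ B`, and it wins `G` with probability at least `1 - δ`. The
resulting inequality (`expVal_ge_of_consistent`) is linear in `δ`, so it averages over `(x, y)`
without loss (`Strategy.value_isolated`), and a suitable choice of the free parameter `t` gives
`s'`.

Completeness. For a PCC strategy the oracle measures the product `A^x_a B^y_b`. All honest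
measurements belonging to one pair `(x, y)` are then functions of a single projective measurement
(`Strategy.orMeas_roleQuestion`), so they commute. Consistency moves the second player's operator to
the first tensor factor, hence the answers are distributed as if one outcome `(a, b)` of the
original strategy were drawn and each player reported the part that the role requires
(`Strategy.corr_oracular`). PCC and perfect play are inherited.

Zero knowledge. By the same description, the simulator needs only a simulated pair `(a, b)` for `(x,
y)`, which it formats according to the roles. On the self-loops at A and B one of the two questions
is unknown. The simulator fills it in with a question from a fixed run of the sampler; by
no-signalling (`Strategy.corr_map_fst`, `Strategy.corr_map_snd`) this does not affect the answers
that are reported. The completed pair may be one that an honest verifier never asks, which is why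
the original protocol must be zero-knowledge against dishonest verifiers. Formatting does not
increase statistical distance, and it can be absorbed into a distinguisher, so all three flavours
carry over.

Efficiency. Polynomial time is shown to be closed under pairing, composition, case distinction and
folds with polynomially bounded state (`PolyTime.foldl`); the new sampler, verifier and simulator
are assembled from these. -/

theorem polyEval_mono (p : Polynomial ℕ) {m n : ℕ} (h : m ≤ n) : p.eval m ≤ p.eval n := by
  simp only [Polynomial.eval_eq_sum_range]
  exact Finset.sum_le_sum fun i _ => Nat.mul_le_mul_left _ (Nat.pow_le_pow_left h i)

theorem Tr.size_pos (x : Tr) : 0 < x.size := by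
  cases x <;> simp only [Tr.size] <;> omega

theorem Tr.size_left_le (x : Tr) : x.left.size ≤ x.size := by
  cases x <;> simp only [Tr.size, Tr.left] <;> omega

theorem Tr.size_right_le (x : Tr) : x.right.size ≤ x.size := by
  cases x <;> simp only [Tr.size, Tr.right] <;> omega

/-- Every operation is charged for the tree it handles, so a time bound is also a bound on the
output. This is what keeps composition polynomial. -/
theorem Eval.size_le {c : Code} {x y : Tr} {t : ℕ} (h : Eval c x y t) : y.size ≤ t := by
  induction h with
  | id x => exact le_rfl
  | leaf x => exact x.size_pos
  | left x => exact x.size_left_le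
  | right x => exact x.size_right_le
  | pair _ _ h1 h2 => simp only [Tr.size]; omega
  | comp _ _ _ h2 => omega
  | branch_leaf _ _ h => omega
  | branch_node _ _ h => omega
  | loop_stop _ => exact le_rfl
  | loop_step _ _ _ _ h => omega

/-- The number of nodes of the tree that represents an element. -/
def codeSize {α : Type} [Coded α] (x : α) : ℕ := (Coded.toTr x).size

section

variable {α β γ δ : Type} [Coded α] [Coded β] [Coded γ] [Coded δ]

attribute [fun_prop] PolyTime

@[fun_prop]
theorem PolyTime.id : PolyTime fun x : α => x :=
  ⟨.id, .X, fun x => ⟨_, by simp, .id _⟩⟩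

@[fun_prop]
theorem PolyTime.comp {f : β → γ} {g : α → β} (hf : PolyTime f) (hg : PolyTime g) :
    PolyTime fun x => f (g x) := by
  obtain ⟨c, p, hc⟩ := hf
  obtain ⟨d, q, hd⟩ := hg
  refine ⟨.comp c d, q + p.comp q + 1, fun x => ?_⟩
  obtain ⟨t, ht, he⟩ := hd x
  obtain ⟨t', ht', he'⟩ := hc (g x)
  refine ⟨_, ?_, .comp he he'⟩
  have := ht'.trans (polyEval_mono p (he.size_le.trans ht))
  simp only [Polynomial.eval_add, Polynomial.eval_comp, Polynomial.eval_one]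
  omega

@[fun_prop]
theorem PolyTime.prodMk {f : α → β} {g : α → γ} (hf : PolyTime f) (hg : PolyTime g) :
    PolyTime fun x => (f x, g x) := by
  obtain ⟨c, p, hc⟩ := hf
  obtain ⟨d, q, hd⟩ := hg
  refine ⟨.pair c d, p + q + 1, fun x => ?_⟩
  obtain ⟨t, ht, he⟩ := hc x
  obtain ⟨t', ht', he'⟩ := hd x
  refine ⟨_, ?_, .pair he he'⟩
  simp only [Polynomial.eval_add, Polynomial.eval_one]
  omega

theorem PolyTime.ofLeft {f : α → β} (h : ∀ x, (Coded.toTr x).left = Coded.toTr (f x)) :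
    PolyTime f :=
  ⟨.left, .X, fun x => ⟨(Coded.toTr x).size, by simp, h x ▸ Eval.left _⟩⟩

theorem PolyTime.ofRight {f : α → β} (h : ∀ x, (Coded.toTr x).right = Coded.toTr (f x)) :
    PolyTime f :=
  ⟨.right, .X, fun x => ⟨(Coded.toTr x).size, by simp, h x ▸ Eval.right _⟩⟩

theorem PolyTime.ofEq {f : α → β} (h : ∀ x, Coded.toTr x = Coded.toTr (f x)) :
    PolyTime f :=
  ⟨.id, .X, fun x => ⟨(Coded.toTr x).size, by simp, h x ▸ Eval.id _⟩⟩

@[fun_prop]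
theorem PolyTime.fst {f : α → β × γ} (hf : PolyTime f) : PolyTime fun x => (f x).1 :=
  PolyTime.comp (f := Prod.fst) (.ofLeft fun _ => rfl) hf

@[fun_prop]
theorem PolyTime.snd {f : α → β × γ} (hf : PolyTime f) : PolyTime fun x => (f x).2 :=
  PolyTime.comp (f := Prod.snd) (.ofRight fun _ => rfl) hf

theorem exists_const_code (y : Tr) : ∃ (c : Code) (p : Polynomial ℕ), ∀ x : Tr,
    ∃ t ≤ p.eval x.size, Eval c x y t := by
  induction y with
  | leaf => exact ⟨.leaf, .X, fun x => ⟨_, by simp, .leaf x⟩⟩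
  | node l r hl hr =>
    obtain ⟨c, p, hc⟩ := hl
    obtain ⟨d, q, hd⟩ := hr
    refine ⟨.pair c d, p + q + 1, fun x => ?_⟩
    obtain ⟨t, ht, he⟩ := hc x
    obtain ⟨t', ht', he'⟩ := hd x
    refine ⟨_, ?_, .pair he he'⟩
    simp only [Polynomial.eval_add, Polynomial.eval_one]
    omega

@[fun_prop]
theorem PolyTime.const (y : β) : PolyTime fun _ : α => y := by
  obtain ⟨c, p, h⟩ := exists_const_code (Coded.toTr y)
  exact ⟨c, p, fun x => h _⟩

/-- Branching on whether the tree of `g x` is a leaf. -/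
theorem PolyTime.branch {b : α → Bool} {g : α → δ} {f₁ f₂ : α → β} (hg : PolyTime g)
    (hb : ∀ x, b x = true ↔ Coded.toTr (g x) ≠ .leaf) (h₁ : PolyTime f₁) (h₂ : PolyTime f₂) :
    PolyTime fun x => bif b x then f₁ x else f₂ x := by
  obtain ⟨c, p, hc⟩ := hg
  obtain ⟨c₁, p₁, hc₁⟩ := h₁
  obtain ⟨c₂, p₂, hc₂⟩ := h₂
  -- The input is kept next to `g x`: the test looks at `g x` as the left subtree, and both branches
  -- recover `x` from the right one.
  refine ⟨.comp (.branch (.comp c₂ .right) (.comp c₁ .right)) (.pair c .id),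
    3 * p + 3 * .X + p₁ + p₂ + 10, fun x => ?_⟩
  obtain ⟨t, ht, he⟩ := hc x
  obtain ⟨t₁, ht₁, he₁⟩ := hc₁ x
  obtain ⟨t₂, ht₂, he₂⟩ := hc₂ x
  have hs := he.size_le
  by_cases h : b x = true
  · refine ⟨_, ?_, .comp (.pair he (.id _)) (.branch_node ((hb x).1 h)
      (.comp (.right _) (by simpa [h, Tr.right] using he₁)))⟩
    simp [Tr.size]
    omega
  · have hb' : Coded.toTr (g x) = .leaf := by
      by_contra h'
      exact h ((hb x).2 h')
    refine ⟨_, ?_, .comp (.pair he (.id _)) (.branch_leaf hb'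
      (.comp (.right _) (by simpa [h, Tr.right] using he₂)))⟩
    simp [Tr.size]
    omega

@[fun_prop]
theorem PolyTime.cond {b : α → Bool} {f₁ f₂ : α → β} (hb : PolyTime b) (h₁ : PolyTime f₁)
    (h₂ : PolyTime f₂) : PolyTime fun x => bif b x then f₁ x else f₂ x :=
  .branch hb (fun x => by cases b x <;> simp [Coded.toTr]) h₁ h₂

@[fun_prop]
theorem PolyTime.and {b c : α → Bool} (hb : PolyTime b) (hc : PolyTime c) :
    PolyTime fun x => b x && c x := by
  have : (fun x => b x && c x) = fun x => bif b x then c x else false := by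
    funext x; cases b x <;> rfl
  rw [this]
  fun_prop

@[fun_prop]
theorem PolyTime.not {b : α → Bool} (hb : PolyTime b) : PolyTime fun x => !(b x) := by
  have : (fun x => !(b x)) = fun x => bif b x then false else true := by
    funext x; cases b x <;> rfl
  rw [this]
  fun_prop

@[fun_prop]
theorem PolyTime.beq {b c : α → Bool} (hb : PolyTime b) (hc : PolyTime c) :
    PolyTime fun x => b x == c x := by
  have : (fun x => b x == c x) = fun x => bif b x then c x else !(c x) := by
    funext x; cases b x <;> cases c x <;> rfl
  rw [this]
  fun_prop

@[fun_prop]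
theorem PolyTime.cons {f : α → β} {g : α → List β} (hf : PolyTime f) (hg : PolyTime g) :
    PolyTime fun x => f x :: g x :=
  PolyTime.comp (f := fun z : β × List β => z.1 :: z.2) (.ofEq fun _ => rfl) (hf.prodMk hg)

@[fun_prop]
theorem PolyTime.tail {g : α → List β} (hg : PolyTime g) : PolyTime fun x => (g x).tail :=
  PolyTime.comp (f := List.tail) (.ofRight fun l => by cases l <;> rfl) hg

@[fun_prop]
theorem PolyTime.isEmpty {g : α → List β} (hg : PolyTime g) :
    PolyTime fun x => (g x).isEmpty := by
  -- The non-leaf case of a branch corresponds to `true`, and a list is a non-leaf exactly when it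
  -- is nonempty, hence the double negation.
  have : (fun x => (g x).isEmpty) = fun x => bif !(g x).isEmpty then false else true := by
    funext x; cases (g x).isEmpty <;> rfl
  rw [this]
  refine .branch hg (fun x => ?_) (.const _) (.const _)
  cases g x <;> simp [Coded.toTr, listTr]

/-- The left subtree of a leaf is a leaf, so taking the head by `left` forces the default value to
be coded by a leaf. -/
theorem PolyTime.headD {d : β} (hd : Coded.toTr d = .leaf) {g : α → List β} (hg : PolyTime g) :
    PolyTime fun x => (g x).headD d :=
  PolyTime.comp (f := fun l : List β => l.headD d)
    (.ofLeft fun l => by cases l; exacts [hd.symm, rfl]) hg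

@[fun_prop]
theorem PolyTime.headDBool {g : α → List Bool} (hg : PolyTime g) :
    PolyTime fun x => (g x).headD false := .headD rfl hg

@[fun_prop]
theorem PolyTime.headDNat {g : α → List ℕ} (hg : PolyTime g) :
    PolyTime fun x => (g x).headD 0 := .headD rfl hg

-- Truncated subtraction agrees with the convention that the right subtree of a leaf is a leaf.
@[fun_prop]
theorem PolyTime.pred {g : α → ℕ} (hg : PolyTime g) : PolyTime fun x => g x - 1 :=
  PolyTime.comp (f := fun n => n - 1) (.ofRight fun n => by cases n <;> rfl) hg

@[fun_prop]
theorem PolyTime.isZero {g : α → ℕ} (hg : PolyTime g) : PolyTime fun x => g x == 0 := by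
  have : (fun x => g x == 0) = fun x => bif !(g x == 0) then false else true := by
    funext x; cases (g x == 0) <;> rfl
  rw [this]
  refine .branch hg (fun x => ?_) (.const _) (.const _)
  cases g x <;> simp [Coded.toTr, unaryTr]

/-! ### Sizes of encodings, and folds over lists. -/

theorem codeSize_nil : codeSize ([] : List α) = 1 := rfl

theorem codeSize_cons (a : α) (l : List α) : codeSize (a :: l) = 1 + codeSize a + codeSize l := rfl

theorem codeSize_prod (z : α × β) : codeSize z = 1 + codeSize z.1 + codeSize z.2 := rfl

theorem codeSize_pos (a : α) : 0 < codeSize a := Tr.size_pos _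

theorem codeSize_append (l l' : List α) : codeSize (l ++ l') + 1 = codeSize l + codeSize l' := by
  induction l with
  | nil => simp [codeSize_nil, Nat.add_comm]
  | cons a l ih => simp only [List.cons_append, codeSize_cons]; omega

theorem codeSize_bool_le (b : Bool) : codeSize b ≤ 3 := by cases b <;> decide

theorem codeSize_tail_le (l : List α) : codeSize l.tail ≤ codeSize l := by
  cases l <;> simp [codeSize_cons, codeSize_nil]

theorem length_lt_codeSize (l : List α) : l.length < codeSize l := by
  induction l with
  | nil => simp [codeSize_nil]
  | cons a l ih => simp only [List.length_cons, codeSize_cons]; have := codeSize_pos a; omega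

/-- The loop runs on pairs of a remaining list and a state; the left subtree is a leaf exactly when
the list is exhausted. `B` bounds the size of all intermediate pairs, hence the cost of each round.
-/
theorem eval_loop_foldl {f : β → α → β} {c : Code} {p : Polynomial ℕ}
    (hc : ∀ z : List α × β, z.1 ≠ [] → ∀ a, z.1.head? = some a →
      ∃ t ≤ p.eval (codeSize z), Eval c (Coded.toTr z) (Coded.toTr (z.1.tail, f z.2 a)) t)
    (B : ℕ) (l : List α) (s : β)
    (hB : ∀ l₁ l₂, l = l₁ ++ l₂ → codeSize (l₂, l₁.foldl f s) ≤ B) :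
    ∃ t ≤ (l.length + 1) * (B + p.eval B),
      Eval (.loop c) (Coded.toTr (l, s)) (Coded.toTr (([] : List α), l.foldl f s)) t := by
  induction l generalizing s with
  | nil =>
    refine ⟨(Coded.toTr (([] : List α), s)).size, ?_, by constructor; rfl⟩
    have := hB [] [] rfl
    simp only [List.foldl_nil, codeSize] at this
    simp only [List.length_nil]
    omega
  | cons a l ih =>
    obtain ⟨t, ht, he⟩ := ih (f s a) fun l₁ l₂ h => hB (a :: l₁) l₂ (by simp [h])
    obtain ⟨t', ht', he'⟩ := hc (a :: l, s) (by simp) a rfl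
    have h0 := hB [] (a :: l) rfl
    refine ⟨_, ?_, .loop_step (by simp [Coded.toTr, Tr.left, listTr]) he' he⟩
    have h1 := polyEval_mono p h0
    simp only [List.foldl_nil, codeSize] at h0 h1 ht'
    simp only [List.length_cons]
    have : (l.length + 1 + 1) * (B + p.eval B) =
      (l.length + 1) * (B + p.eval B) + (B + p.eval B) := by ring
    omega

/-- A polynomial-time step alone is not enough, since the state could grow exponentially under
iteration. The hypothesis `hq` excludes this; quantified over all lists, it applies to every prefix
and so to every intermediate state. -/
theorem PolyTime.foldl {f : β → α → β} (hf : PolyTime fun z : β × α => f z.1 z.2)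
    (q : Polynomial ℕ)
    (hq : ∀ (s : β) (l : List α), codeSize (l.foldl f s) ≤ q.eval (codeSize s + codeSize l))
    {g : γ → List α} {h : γ → β} (hg : PolyTime g) (hh : PolyTime h) :
    PolyTime fun x => (g x).foldl f (h x) := by
  suffices H : PolyTime fun x : List α × β => x.1.foldl f x.2 from H.comp (hg.prodMk hh)
  obtain ⟨c, p, hc⟩ := hf
  -- Sends `(a :: l, s)` to `(l, f s a)`.
  let body : Code := .pair (.comp .right .left)
    (.comp c (.pair .right (.comp .left .left)))
  have hbody : ∀ z : List α × β, z.1 ≠ [] → ∀ a, z.1.head? = some a →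
      ∃ t ≤ (p + 10 * .X + 10 : Polynomial ℕ).eval (codeSize z),
        Eval body (Coded.toTr z) (Coded.toTr (z.1.tail, f z.2 a)) t := by
    rintro ⟨l, s⟩ hl a ha
    obtain ⟨a', l, rfl⟩ := List.exists_cons_of_ne_nil hl
    obtain rfl : a' = a := by simpa using ha
    obtain ⟨t, ht, he⟩ := hc (s, a')
    refine ⟨_, ?_, .pair (.comp (.left _) (.right _))
      (.comp (.pair (.right _) (.comp (.left _) (.left _))) he)⟩
    have h1 : codeSize (s, a') ≤ codeSize (a' :: l, s) := by
      simp only [codeSize_prod, codeSize_cons]; omega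
    have h2 := polyEval_mono p h1
    simp only [codeSize, Polynomial.eval_add, Polynomial.eval_mul, Polynomial.eval_X,
      Polynomial.eval_ofNat] at *
    have h3 : (Coded.toTr (a' :: l, s)).left.size ≤ (Coded.toTr (a' :: l, s)).size :=
      Tr.size_left_le _
    omega
  let B : Polynomial ℕ := q + 3 * .X + 1
  refine ⟨.comp .right (.loop body), (.X + 1) * (B + (p + 10 * .X + 10).comp B) +
    B + 2, ?_⟩
  rintro ⟨l, s⟩
  obtain ⟨t, ht, he⟩ := eval_loop_foldl hbody (B.eval (codeSize (l, s))) l s (by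
    rintro l₁ l₂ rfl
    have h1 := hq s l₁
    have h2 := codeSize_append l₁ l₂
    have h3 := codeSize_pos l₁
    have h3 := codeSize_pos l₂
    have h4 := polyEval_mono q (show codeSize s + codeSize l₁ ≤ codeSize (l₁ ++ l₂, s) by
      simp only [codeSize_prod]; omega)
    simp only [B, Polynomial.eval_add, Polynomial.eval_mul, Polynomial.eval_X,
      Polynomial.eval_ofNat, Polynomial.eval_one]
    simp only [codeSize_prod] at *
    omega)
  refine ⟨_, ?_, .comp he (.right _)⟩
  have h5 : codeSize (([] : List α), l.foldl f s) ≤ B.eval (codeSize (l, s)) := by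
    have h1 := hq s l
    have h4 := polyEval_mono q (show codeSize s + codeSize l ≤ codeSize (l, s) by
      simp only [codeSize_prod]; omega)
    have := codeSize_pos s
    simp only [B, Polynomial.eval_add, Polynomial.eval_mul, Polynomial.eval_X,
      Polynomial.eval_ofNat, Polynomial.eval_one]
    simp only [codeSize_prod, codeSize_nil] at *
    omega
  have h6 : l.length ≤ codeSize (l, s) := by
    have := length_lt_codeSize l
    simp only [codeSize_prod]; omega
  have h7 := Nat.mul_le_mul_right (B.eval (codeSize (l, s)) +
    (p + 10 * .X + 10 : Polynomial ℕ).eval (B.eval (codeSize (l, s)))) (Nat.succ_le_succ h6)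
  simp only [codeSize] at *
  simp only [Polynomial.eval_add (p := _ * _ + _), Polynomial.eval_add (p := _ * _),
    Polynomial.eval_mul (p := _ + _) (q := _ + Polynomial.comp _ _),
    Polynomial.eval_add (p := B),  Polynomial.eval_comp,
    Polynomial.eval_add (p := Polynomial.X),
    Polynomial.eval_X, Polynomial.eval_ofNat, Polynomial.eval_one]
  simp only [Nat.succ_eq_add_one] at h7
  omega

end

/-! ## Polynomial-time operations on strings -/

section

variable {α β : Type} [Coded α] [Coded β]

theorem codeSize_reverse (l : List α) : codeSize l.reverse = codeSize l := by
  induction l with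
  | nil => rfl
  | cons a l ih =>
    have := codeSize_append l.reverse [a]
    rw [List.reverse_cons, codeSize_cons]
    simp only [codeSize_cons, codeSize_nil] at this
    omega

@[fun_prop]
theorem PolyTime.reverse {g : α → List β} (hg : PolyTime g) :
    PolyTime fun x => (g x).reverse := by
  have : (fun x => (g x).reverse) = fun x => (g x).foldl (fun acc b => b :: acc) [] := by
    funext x; rw [List.foldl_flip_cons_eq_append', List.append_nil]
  rw [this]
  refine .foldl (by fun_prop) .X (fun s l => ?_) hg (.const _)
  rw [List.foldl_flip_cons_eq_append']
  have := codeSize_append l.reverse s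
  rw [codeSize_reverse] at this
  rw [Polynomial.eval_X]
  omega

/-- One step of the comparison of two strings. -/
def eqStep (s : Bool × Str) (b : Bool) : Bool × Str :=
  (s.1 && !s.2.isEmpty && (s.2.headD false == b), s.2.tail)

/-- The flag records agreement so far and the second component is the unread part of `t`; the
strings are equal when the flag survives and nothing is left unread. -/
theorem foldl_eqStep (l t : Str) (c : Bool) :
    ((l.foldl eqStep (c, t)).1 && (l.foldl eqStep (c, t)).2.isEmpty) = (c && decide (l = t)) := by
  induction l generalizing t c with
  | nil => cases t <;> simp
  | cons a l ih =>
    cases t with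
    | nil => simp [eqStep, ih]
    | cons b t =>
      simp only [List.foldl_cons, eqStep, ih]
      cases c <;> cases a <;> cases b <;> simp <;> rfl

@[fun_prop]
theorem PolyTime.strEq {f g : α → Str} (hf : PolyTime f) (hg : PolyTime g) :
    PolyTime fun x => decide (f x = g x) := by
  have : (fun x => decide (f x = g x)) = fun x =>
      (((f x).foldl eqStep (true, g x)).1 && ((f x).foldl eqStep (true, g x)).2.isEmpty) := by
    funext x; simp [foldl_eqStep]
  rw [this]
  have H : PolyTime fun x => (f x).foldl eqStep (true, g x) := by
    -- The unread string only shrinks and the flag has bounded size.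
    refine .foldl (by unfold eqStep; fun_prop) (.X + 10) (fun s l => ?_) hf (by fun_prop)
    have h1 : codeSize (l.foldl eqStep s).2 ≤ codeSize s.2 := by
      induction l generalizing s with
      | nil => exact le_rfl
      | cons a l ih => exact (ih _).trans (codeSize_tail_le _)
    have h2 := codeSize_bool_le (l.foldl eqStep s).1
    rw [codeSize_prod, codeSize_prod, Polynomial.eval_add, Polynomial.eval_X,
      Polynomial.eval_ofNat]
    omega
  fun_prop

theorem foldl_pairStr (u v : Str) :
    u.reverse.foldl (fun acc b => true :: b :: acc) (false :: v) = pairStr u v := by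
  rw [List.foldl_reverse]
  induction u with
  | nil => rfl
  | cons b u ih => rw [List.foldr_cons, ih, pairStr]

@[fun_prop]
theorem PolyTime.pairStr {f g : α → Str} (hf : PolyTime f) (hg : PolyTime g) :
    PolyTime fun x => pairStr (f x) (g x) := by
  simp only [← foldl_pairStr]
  refine .foldl (by fun_prop) (5 * .X) (fun s l => ?_) (by fun_prop) (by fun_prop)
  rw [Polynomial.eval_mul, Polynomial.eval_X, Polynomial.eval_ofNat]
  suffices codeSize (l.foldl (fun acc b => true :: b :: acc) s) ≤ codeSize s + 5 * codeSize l by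
    omega
  induction l generalizing s with
  | nil => exact Nat.le_add_right _ _
  | cons a l ih =>
    have := ih (true :: a :: s)
    have h := codeSize_pos a
    have h3 : codeSize true = 3 := rfl
    simp only [List.foldl_cons, codeSize_cons] at this ⊢
    omega

/-- One step of the decoding of a pair of strings. -/
def unpairStep (s : Str × Str) (_ : Bool) : Str × Str :=
  bif s.2.headD false && !s.2.tail.isEmpty then (s.2.tail.headD false :: s.1, s.2.tail.tail) else s

/-- Decoding of pairs of strings, a left inverse of `pairStr`. -/
def unpairStr (z : Str) : Str × Str :=
  ((z.foldl unpairStep ([], z)).1.reverse, (z.foldl unpairStep ([], z)).2.tail)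

theorem foldl_unpairStep_done (acc v l : Str) :
    l.foldl unpairStep (acc, false :: v) = (acc, false :: v) := by
  induction l with
  | nil => rfl
  | cons a l ih => simpa [unpairStep] using ih

/-- The list `l` serves only as a clock: its entries are ignored, and the state is stationary once
the separator `false` is reached. Any clock at least as long as `u` works, in particular the encoded
string itself. -/
theorem foldl_unpairStep (acc u v l : Str) (h : u.length ≤ l.length) :
    l.foldl unpairStep (acc, pairStr u v) = (u.reverse ++ acc, false :: v) := by
  induction u generalizing acc l with
  | nil => simpa [pairStr] using foldl_unpairStep_done acc v l
  | cons b u ih =>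
    cases l with
    | nil => simp at h
    | cons a l =>
      have := ih (b :: acc) l (by simpa using h)
      simpa [pairStr, unpairStep] using this

theorem length_pairStr (u v : Str) : (pairStr u v).length = 2 * u.length + 1 + v.length := by
  induction u with
  | nil => simp [pairStr]; omega
  | cons b u ih => simp [pairStr, ih]; omega

@[simp]
theorem unpairStr_pairStr (u v : Str) : unpairStr (pairStr u v) = (u, v) := by
  have := foldl_unpairStep [] u v (pairStr u v) (by rw [length_pairStr]; omega)
  simp [unpairStr, this]

theorem codeSize_unpairStep_le (s : Str × Str) (b : Bool) :
    codeSize (unpairStep s b) ≤ codeSize s := by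
  obtain ⟨acc, z⟩ := s
  rcases z with _ | ⟨_ | _, _ | ⟨d, z⟩⟩
  any_goals exact le_rfl
  simp only [unpairStep, codeSize_prod, codeSize_cons, List.headD_cons, List.tail_cons,
    List.isEmpty_cons, Bool.not_false, Bool.and_self, cond_true]
  omega

@[fun_prop]
theorem PolyTime.unpairStr {f : α → Str} (hf : PolyTime f) :
    PolyTime fun x => unpairStr (f x) := by
  have H : PolyTime fun x => (f x).foldl unpairStep ([], f x) := by
    refine .foldl (by unfold unpairStep; fun_prop) .X (fun s l => ?_) hf (by fun_prop)
    rw [Polynomial.eval_X]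
    induction l generalizing s with
    | nil => exact Nat.le_add_right _ _
    | cons a l ih =>
      have h1 := ih (unpairStep s a)
      have h2 := codeSize_unpairStep_le s a
      rw [List.foldl_cons, codeSize_cons]
      omega
  unfold ZKOR.unpairStr
  fun_prop

attribute [irreducible] unpairStr

theorem PolyTime.zeros {g : α → List β} (hg : PolyTime g) :
    PolyTime fun x => List.replicate (g x).length (0 : ℕ) := by
  have key : ∀ (l : List β) (k : ℕ),
      l.foldl (fun (acc : List ℕ) (_ : β) => 0 :: acc) (List.replicate k 0) =
        List.replicate (k + l.length) 0 := by
    intro l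
    induction l with
    | nil => intro k; rfl
    | cons a l ih =>
      intro k
      rw [List.foldl_cons, ← List.replicate_succ, ih, List.length_cons]
      congr 1; omega
  have : (fun x => List.replicate (g x).length (0 : ℕ)) = fun x =>
      (g x).foldl (fun (acc : List ℕ) (_ : β) => 0 :: acc) [] := by
    funext x
    rw [← Nat.zero_add (g x).length]
    exact (key (g x) 0).symm
  rw [this]
  refine .foldl (by fun_prop) (3 * .X) (fun s l => ?_) hg (by fun_prop)
  rw [Polynomial.eval_mul, Polynomial.eval_X, Polynomial.eval_ofNat]
  suffices codeSize (l.foldl (fun acc _ => 0 :: acc) s) ≤ codeSize s + 2 * codeSize l by omega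
  induction l generalizing s with
  | nil => exact Nat.le_add_right _ _
  | cons a l ih =>
    have := ih (0 :: s)
    have h0 : codeSize (0 : ℕ) = 1 := rfl
    have := codeSize_pos a
    simp only [List.foldl_cons, codeSize_cons] at *
    omega

end

open scoped ComplexOrder

/-! ## Projective measurements -/

section

variable {n : Type*} [Fintype n]

/-- The squared norm of a vector. -/
noncomputable def nsq (v : n → ℂ) : ℝ := ∑ i, Complex.normSq (v i)

theorem nsq_nonneg (v : n → ℂ) : 0 ≤ nsq v :=
  Finset.sum_nonneg fun _ _ => Complex.normSq_nonneg _

theorem star_dotProduct_self (v : n → ℂ) : star v ⬝ᵥ v = (nsq v : ℂ) := by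
  simp [nsq, dotProduct, Complex.normSq_eq_conj_mul_self]

theorem nsq_eq_zero {v : n → ℂ} : nsq v = 0 ↔ v = 0 := by
  rw [← Complex.ofReal_eq_zero, ← star_dotProduct_self]
  exact dotProduct_star_self_eq_zero

/-- Young's inequality in each coordinate. The value `t = 1` serves as a triangle inequality; a
general `t` keeps the factor of the main term adjustable. -/
theorem nsq_add_le (u v : n → ℂ) {t : ℝ} (ht : 0 < t) :
    nsq (u + v) ≤ (1 + t) * nsq u + (1 + 1 / t) * nsq v := by
  simp only [nsq, Finset.mul_sum, ← Finset.sum_add_distrib]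
  refine Finset.sum_le_sum fun i _ => ?_
  simp only [Complex.normSq_apply, Pi.add_apply, Complex.add_re, Complex.add_im]
  have key : ∀ a b : ℝ, (a + b) * (a + b) ≤ (1 + t) * (a * a) + (1 + 1 / t) * (b * b) := by
    intro a b
    have : (1 + t) * (a * a) + (1 + 1 / t) * (b * b) - (a + b) * (a + b) =
        t * (a - b / t) ^ 2 := by field_simp; ring
    nlinarith [mul_nonneg ht.le (sq_nonneg (a - b / t))]
  nlinarith [key (u i).re (v i).re, key (u i).im (v i).im]

theorem nsq_sub (u v : n → ℂ) : nsq (u - v) = nsq u + nsq v - 2 * (star u ⬝ᵥ v).re := by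
  simp only [nsq, dotProduct, Complex.re_sum, Finset.mul_sum, ← Finset.sum_add_distrib,
    ← Finset.sum_sub_distrib]
  refine Finset.sum_congr rfl fun i _ => ?_
  simp [Complex.normSq_apply]
  ring

theorem star_dotProduct_mulVec {K : Matrix n n ℂ} (hK : IsSelfAdjoint K) (u v : n → ℂ) :
    star u ⬝ᵥ (K *ᵥ v) = star (K *ᵥ u) ⬝ᵥ v := by
  have h : Kᴴ = K := hK
  rw [Matrix.star_mulVec, Matrix.dotProduct_mulVec, h]

theorem re_star_dotProduct_mulVec {K : Matrix n n ℂ} (hK : IsStarProjection K) (v : n → ℂ) :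
    (star v ⬝ᵥ (K *ᵥ v)).re = nsq (K *ᵥ v) := by
  have h : K * K = K := hK.isIdempotentElem
  rw [← h, ← Matrix.mulVec_mulVec, star_dotProduct_mulVec hK.isSelfAdjoint,
    star_dotProduct_self, Matrix.mulVec_mulVec, h, Complex.ofReal_re]

variable [DecidableEq n]

/-- Projective measurements. -/
structure IsPVM {ι : Type*} [Fintype ι] (M : ι → Matrix n n ℂ) : Prop where
  proj : ∀ c, IsStarProjection (M c)
  sum_one : ∑ c, M c = 1

variable {ι κ : Type*} [Fintype ι] [Fintype κ]

theorem IsPVM.sum_nsq {M : ι → Matrix n n ℂ} (hM : IsPVM M) (v : n → ℂ) :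
    ∑ c, nsq (M c *ᵥ v) = nsq v := by
  simp only [← re_star_dotProduct_mulVec (hM.proj _)]
  rw [← Complex.re_sum, ← dotProduct_sum, ← Matrix.sum_mulVec, hM.sum_one, Matrix.one_mulVec,
    star_dotProduct_self, Complex.ofReal_re]

/-- In the identity `∑ c, ‖M c w‖² = ‖w‖²` for `w = M b v`, the term `c = b` already accounts for
the whole right-hand side, so all other terms vanish. -/
theorem IsPVM.mul_eq_zero {M : ι → Matrix n n ℂ} (hM : IsPVM M) {a b : ι} (h : a ≠ b) :
    M a * M b = 0 := by
  classical
  refine Matrix.ext_iff_mulVec.2 fun v => ?_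
  have h1 := hM.sum_nsq (M b *ᵥ v)
  have hb : M b * M b = M b := (hM.proj b).isIdempotentElem
  rw [← Finset.add_sum_erase _ _ (Finset.mem_univ b), Matrix.mulVec_mulVec, hb] at h1
  have h2 : ∑ c ∈ Finset.univ.erase b, nsq (M c *ᵥ M b *ᵥ v) = 0 := by linarith
  rw [Finset.sum_eq_zero_iff_of_nonneg fun _ _ => nsq_nonneg _] at h2
  have h3 := nsq_eq_zero.1 (h2 a (Finset.mem_erase.2 ⟨h, Finset.mem_univ _⟩))
  rw [← Matrix.mulVec_mulVec, h3, Matrix.zero_mulVec]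

theorem IsPVM.mul_eq {M : ι → Matrix n n ℂ} [DecidableEq ι] (hM : IsPVM M) (a b : ι) :
    M a * M b = if a = b then M a else 0 := by
  split_ifs with h
  · rw [← h]; exact (hM.proj a).isIdempotentElem
  · exact hM.mul_eq_zero h

theorem IsPVM.mul {M : ι → Matrix n n ℂ} {N : κ → Matrix n n ℂ} (hM : IsPVM M) (hN : IsPVM N)
    (h : ∀ a b, M a * N b = N b * M a) : IsPVM fun p : ι × κ => M p.1 * N p.2 where
  proj p := (hM.proj p.1).mul (hN.proj p.2) (h _ _)
  sum_one := by
    rw [Fintype.sum_prod_type, ← Finset.sum_mul_sum, hM.sum_one, hN.sum_one, mul_one]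

/-- The measurement that applies `g` to the outcome of `M`. -/
noncomputable def coarse [DecidableEq κ] (g : ι → κ) (M : ι → Matrix n n ℂ) (c : κ) :
    Matrix n n ℂ :=
  ∑ p, if g p = c then M p else 0

variable [DecidableEq κ]

theorem IsPVM.coarse {M : ι → Matrix n n ℂ} (hM : IsPVM M) (g : ι → κ) : IsPVM (coarse g M) where
  proj c := by
    classical
    constructor
    · simp only [ZKOR.coarse, IsIdempotentElem, Finset.sum_mul, Finset.mul_sum, ite_mul, mul_ite,
        hM.mul_eq, zero_mul, mul_zero]
      refine Finset.sum_congr rfl fun p _ => ?_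
      split_ifs with h
      · rw [Finset.sum_eq_single p] <;> simp +contextual [h]
      · rfl
    · refine isSelfAdjoint_sum _ fun p _ => ?_
      split_ifs
      exacts [(hM.proj p).isSelfAdjoint, .zero _]
  sum_one := by
    simp only [ZKOR.coarse]
    rw [Finset.sum_comm]
    simpa using hM.sum_one

theorem coarse_coarse {ν : Type*} [DecidableEq ν] (g : ι → κ) (h : κ → ν)
    (M : ι → Matrix n n ℂ) : coarse h (coarse g M) = coarse (h ∘ g) M := by
  funext c
  simp only [coarse, Function.comp_apply, ← Finset.sum_filter]
  rw [Finset.sum_comm' (t' := Finset.univ.filter fun p => h (g p) = c) (s' := fun p => {g p})]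
  · simp
  · simp only [Finset.mem_filter, Finset.mem_univ, true_and, Finset.mem_singleton]
    grind

variable {m : Type*} [Fintype m] [DecidableEq m]

theorem isStarProjection_kronecker {K : Matrix n n ℂ} {L : Matrix m m ℂ}
    (hK : IsStarProjection K) (hL : IsStarProjection L) : IsStarProjection (K ⊗ₖ L) where
  isIdempotentElem := by
    rw [IsIdempotentElem, ← Matrix.mul_kronecker_mul, hK.isIdempotentElem.eq,
      hL.isIdempotentElem.eq]
  isSelfAdjoint := by
    rw [IsSelfAdjoint, Matrix.star_eq_conjTranspose, Matrix.conjTranspose_kronecker]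
    exact congrArg₂ _ hK.isSelfAdjoint hL.isSelfAdjoint

theorem sum_kronecker (M : ι → Matrix n n ℂ) (L : Matrix m m ℂ) (s : Finset ι) :
    (∑ c ∈ s, M c) ⊗ₖ L = ∑ c ∈ s, M c ⊗ₖ L := by
  ext ⟨i, j⟩ ⟨k, l⟩
  simp [Matrix.sum_apply, Finset.sum_mul]

theorem kronecker_sum (K : Matrix n n ℂ) (M : ι → Matrix m m ℂ) (s : Finset ι) :
    K ⊗ₖ (∑ c ∈ s, M c) = ∑ c ∈ s, K ⊗ₖ M c := by
  ext ⟨i, j⟩ ⟨k, l⟩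
  simp [Matrix.sum_apply, Finset.mul_sum]

theorem IsPVM.kronecker_one {M : ι → Matrix n n ℂ} (hM : IsPVM M) :
    IsPVM fun c => M c ⊗ₖ (1 : Matrix m m ℂ) where
  proj c := isStarProjection_kronecker (hM.proj c) (.one _)
  sum_one := by rw [← sum_kronecker, hM.sum_one, Matrix.one_kronecker_one]

theorem IsPVM.one_kronecker {M : ι → Matrix n n ℂ} (hM : IsPVM M) :
    IsPVM fun c => (1 : Matrix m m ℂ) ⊗ₖ M c where
  proj c := isStarProjection_kronecker (.one _) (hM.proj c)
  sum_one := by rw [← kronecker_sum, hM.sum_one, Matrix.one_kronecker_one]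

end

/-! ## Consistent measurements -/

section

variable {n : Type*} [Fintype n] [DecidableEq n] {α β : Type*} [Fintype α] [Fintype β]

/-- The expectation value `⟨ψ| K |ψ⟩`. -/
noncomputable def expVal (ψ : n → ℂ) (K : Matrix n n ℂ) : ℝ := (star ψ ⬝ᵥ (K *ᵥ ψ)).re

theorem expVal_sum (ψ : n → ℂ) {ι : Type*} (s : Finset ι) (K : ι → Matrix n n ℂ) :
    expVal ψ (∑ i ∈ s, K i) = ∑ i ∈ s, expVal ψ (K i) := by
  simp only [expVal, Matrix.sum_mulVec, dotProduct_sum, Complex.re_sum]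

theorem expVal_of_proj {K : Matrix n n ℂ} (hK : IsStarProjection K) (ψ : n → ℂ) :
    expVal ψ K = nsq (K *ᵥ ψ) := re_star_dotProduct_mulVec hK ψ

theorem nsq_proj_le {K : Matrix n n ℂ} (hK : IsStarProjection K) (v : n → ℂ) :
    nsq (K *ᵥ v) ≤ nsq v := by
  have h := nsq_sub v (K *ᵥ v)
  rw [re_star_dotProduct_mulVec hK] at h
  have := nsq_nonneg (v - K *ᵥ v)
  linarith

theorem expVal_mul_nonneg {K L : Matrix n n ℂ} (hK : IsStarProjection K)
    (hL : IsStarProjection L) (h : K * L = L * K) (ψ : n → ℂ) : 0 ≤ expVal ψ (K * L) := by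
  rw [expVal_of_proj (hK.mul hL h)]
  exact nsq_nonneg _

theorem expVal_mul_le {K L : Matrix n n ℂ} (hK : IsStarProjection K)
    (hL : IsStarProjection L) (h : K * L = L * K) (ψ : n → ℂ) :
    expVal ψ (K * L) ≤ nsq (K *ᵥ ψ) := by
  rw [expVal_of_proj (hK.mul hL h), h, ← Matrix.mulVec_mulVec]
  exact nsq_proj_le hL _

/-- Converts the probability that two measurements agree into a distance between their actions on
the state. -/
theorem IsPVM.sum_nsq_sub {M N : α → Matrix n n ℂ} (hM : IsPVM M) (hN : IsPVM N) (ψ : n → ℂ) :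
    ∑ a, nsq (M a *ᵥ ψ - N a *ᵥ ψ) = 2 * nsq ψ - 2 * ∑ a, expVal ψ (M a * N a) := by
  simp only [nsq_sub, Finset.sum_add_distrib, Finset.sum_sub_distrib, hM.sum_nsq, hN.sum_nsq,
    ← Finset.mul_sum]
  suffices ∑ a, (star (M a *ᵥ ψ) ⬝ᵥ (N a *ᵥ ψ)).re = ∑ a, expVal ψ (M a * N a) by
    rw [this]; ring
  refine Finset.sum_congr rfl fun a _ => ?_
  rw [expVal, ← Matrix.mulVec_mulVec, star_dotProduct_mulVec (hM.proj a).isSelfAdjoint]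

variable [DecidableEq α] [DecidableEq β]

theorem coarse_fst (O : α × β → Matrix n n ℂ) (a : α) :
    coarse Prod.fst O a = ∑ b, O (a, b) := by
  rw [coarse, Fintype.sum_prod_type, Finset.sum_eq_single a] <;> simp +contextual

theorem coarse_snd (O : α × β → Matrix n n ℂ) (b : β) :
    coarse Prod.snd O b = ∑ a, O (a, b) := by
  rw [coarse, Fintype.sum_prod_type_right, Finset.sum_eq_single b] <;> simp +contextual

/-- By orthogonality only the common outcome `(a, b)` of the two marginal sums survives. -/
theorem IsPVM.coarse_fst_mul_coarse_snd {O : α × β → Matrix n n ℂ} (hO : IsPVM O) (a : α) (b : β) :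
    ZKOR.coarse Prod.fst O a * ZKOR.coarse Prod.snd O b = O (a, b) := by
  rw [coarse_fst, coarse_snd, Finset.sum_mul_sum]
  simp only [hO.mul_eq, Prod.mk.injEq]
  rw [Finset.sum_eq_single b, Finset.sum_eq_single a] <;> simp +contextual [eq_comm]

/-- The analytic core of soundness. `A` and `A'` are the isolated measurements of Alice's role by
the first and the second player, `B` is the second player's measurement in Bob's role, `O` is the
oracle's measurement by the first player, and `v` is the winning indicator. The hypotheses say that
three tests pass with probability at least `1 - δ`; the conclusion bounds from below the winning
probability of `A` and `B`. -/
theorem expVal_ge_of_consistent {A A' : α → Matrix n n ℂ} {B : β → Matrix n n ℂ}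
    {O : α × β → Matrix n n ℂ} (hA : IsPVM A) (hA' : IsPVM A') (hB : IsPVM B) (hO : IsPVM O)
    (hAB : ∀ a b, A a * B b = B b * A a) (hOA : ∀ p a, O p * A' a = A' a * O p)
    (hOB : ∀ p b, O p * B b = B b * O p) {ψ : n → ℂ} (hψ : nsq ψ = 1) (v : α × β → ℝ)
    (hv0 : ∀ p, 0 ≤ v p) (hv1 : ∀ p, v p ≤ 1) {δ : ℝ}
    (h1 : 1 - δ ≤ ∑ a, expVal ψ (A a * A' a))
    (h2 : 1 - δ ≤ ∑ p, v p * expVal ψ (O p * A' p.1))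
    (h3 : 1 - δ ≤ ∑ p, v p * expVal ψ (O p * B p.2)) {t : ℝ} (ht : 0 < t) :
    1 - δ * (21 + 20 / t) ≤ (1 + t) * ∑ p, v p * expVal ψ (A p.1 * B p.2) := by
  set OA := coarse Prod.fst O with hOAdef
  set OB := coarse Prod.snd O with hOBdef
  have hOA' : IsPVM OA := hO.coarse _
  have hOB' : IsPVM OB := hO.coarse _
  have e1 : ∑ a, nsq (A a *ᵥ ψ - A' a *ᵥ ψ) ≤ 2 * δ := by
    rw [hA.sum_nsq_sub hA', hψ]; linarith
  have e2 : ∑ a, nsq (OA a *ᵥ ψ - A' a *ᵥ ψ) ≤ 2 * δ := by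
    rw [hOA'.sum_nsq_sub hA', hψ]
    have : ∑ p, v p * expVal ψ (O p * A' p.1) ≤ ∑ a, expVal ψ (OA a * A' a) := by
      simp only [hOAdef, coarse_fst, Finset.sum_mul, expVal_sum]
      rw [← Fintype.sum_prod_type']
      exact Finset.sum_le_sum fun p _ => mul_le_of_le_one_left
        (expVal_mul_nonneg (hO.proj _) (hA'.proj _) (hOA _ _) ψ) (hv1 p)
    linarith
  have e3 : ∑ b, nsq (OB b *ᵥ ψ - B b *ᵥ ψ) ≤ 2 * δ := by
    rw [hOB'.sum_nsq_sub hB, hψ]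
    have : ∑ p, v p * expVal ψ (O p * B p.2) ≤ ∑ b, expVal ψ (OB b * B b) := by
      simp only [hOBdef, coarse_snd, Finset.sum_mul, expVal_sum]
      rw [← Fintype.sum_prod_type_right']
      exact Finset.sum_le_sum fun p _ => mul_le_of_le_one_left
        (expVal_mul_nonneg (hO.proj _) (hB.proj _) (hOB _ _) ψ) (hv1 p)
    linarith
  -- Triangle inequality through `A'`, with constant `2 * 2 + 2 * 2`.
  have e4 : ∑ a, nsq (OA a *ᵥ ψ - A a *ᵥ ψ) ≤ 8 * δ := by
    have : ∀ a, nsq (OA a *ᵥ ψ - A a *ᵥ ψ) ≤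
        2 * nsq (OA a *ᵥ ψ - A' a *ᵥ ψ) + 2 * nsq (A a *ᵥ ψ - A' a *ᵥ ψ) := by
      intro a
      have h := nsq_add_le (OA a *ᵥ ψ - A' a *ᵥ ψ) (A' a *ᵥ ψ - A a *ᵥ ψ) one_pos
      rw [sub_add_sub_cancel] at h
      have h' : nsq (A' a *ᵥ ψ - A a *ᵥ ψ) = nsq (A a *ᵥ ψ - A' a *ᵥ ψ) := by
        simp only [nsq, Pi.sub_apply]
        refine Finset.sum_congr rfl fun i _ => ?_
        rw [← neg_sub, Complex.normSq_neg]
      rw [h'] at h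
      linarith
    have h := Finset.sum_le_sum fun a (_ : a ∈ Finset.univ) => this a
    rw [Finset.sum_add_distrib, ← Finset.mul_sum, ← Finset.mul_sum] at h
    linarith
  have e5 : ∑ p : α × β, nsq (O p *ᵥ ψ - (A p.1 * B p.2) *ᵥ ψ) ≤ 20 * δ := by
    have key : ∀ a b, nsq (O (a, b) *ᵥ ψ - (A a * B b) *ᵥ ψ) ≤
        2 * nsq (B b *ᵥ (OA a *ᵥ ψ - A a *ᵥ ψ)) + 2 * nsq (OA a *ᵥ (OB b *ᵥ ψ - B b *ᵥ ψ)) := by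
      intro a b
      have hc : OA a * B b = B b * OA a := by
        simp only [hOAdef, coarse_fst, Finset.sum_mul, Finset.mul_sum, hOB]
      have h := nsq_add_le (B b *ᵥ (OA a *ᵥ ψ - A a *ᵥ ψ)) (OA a *ᵥ (OB b *ᵥ ψ - B b *ᵥ ψ))
        one_pos
      -- Telescoping `OA OB - A B` through `OA B = B OA`. Summing the squared norms over `b` in the
      -- first term and over `a` in the second removes the outer projections, which leaves `2 * 8 +
      -- 2 * 2 = 20`.
      have e : B b *ᵥ (OA a *ᵥ ψ - A a *ᵥ ψ) + OA a *ᵥ (OB b *ᵥ ψ - B b *ᵥ ψ) =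
          O (a, b) *ᵥ ψ - (A a * B b) *ᵥ ψ := by
        simp only [Matrix.mulVec_sub, Matrix.mulVec_mulVec]
        rw [hOAdef, hOBdef, hO.coarse_fst_mul_coarse_snd, ← hOAdef, hc, hAB]
        abel
      rw [e] at h
      linarith
    rw [Fintype.sum_prod_type]
    have h := Finset.sum_le_sum fun a (_ : a ∈ Finset.univ) =>
      Finset.sum_le_sum fun b (_ : b ∈ Finset.univ) => key a b
    simp only [Finset.sum_add_distrib, ← Finset.mul_sum, hB.sum_nsq] at h
    rw [Finset.sum_comm (f := fun a b => nsq (OA a *ᵥ (OB b *ᵥ ψ - B b *ᵥ ψ)))] at h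
    simp only [hOA'.sum_nsq] at h
    linarith
  -- Dropping `A'` only increases the left-hand side; then `O ψ` is compared with `A B ψ` outcome by
  -- outcome.
  have e6 : ∑ p, v p * expVal ψ (O p * A' p.1) ≤
      (1 + t) * ∑ p, v p * expVal ψ (A p.1 * B p.2) +
        (1 + 1 / t) * ∑ p : α × β, nsq (O p *ᵥ ψ - (A p.1 * B p.2) *ᵥ ψ) := by
    rw [Finset.mul_sum, Finset.mul_sum, ← Finset.sum_add_distrib]
    refine Finset.sum_le_sum fun p _ => ?_
    have h5 := expVal_mul_le (hO.proj p) (hA'.proj p.1) (hOA _ _) ψ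
    have h6 := nsq_add_le ((A p.1 * B p.2) *ᵥ ψ) (O p *ᵥ ψ - (A p.1 * B p.2) *ᵥ ψ) ht
    rw [add_sub_cancel] at h6
    rw [expVal_of_proj ((hA.proj p.1).mul (hB.proj p.2) (hAB _ _))]
    have h7 := mul_le_mul_of_nonneg_left (h5.trans h6) (hv0 p)
    have h8 : v p * ((1 + 1 / t) * nsq (O p *ᵥ ψ - (A p.1 * B p.2) *ᵥ ψ)) ≤
        (1 + 1 / t) * nsq (O p *ᵥ ψ - (A p.1 * B p.2) *ᵥ ψ) :=
      mul_le_of_le_one_left (mul_nonneg (by positivity) (nsq_nonneg _)) (hv1 p)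
    linarith
  have e7 := mul_le_mul_of_nonneg_left e5 (show 0 ≤ 1 + 1 / t by positivity)
  have e8 : (1 + 1 / t) * (20 * δ) = δ * (20 + 20 / t) := by field_simp
  linarith

end

/-! ## Expectations over finite distributions -/

section

variable {α β : Type*} [Fintype α] [Fintype β]

/-- The expectation of a function on a finite type. -/
noncomputable def expect (p : PMF α) (f : α → ℝ) : ℝ := ∑ x, (p x).toReal * f x

theorem sum_toReal (p : PMF α) : ∑ x, (p x).toReal = 1 := by
  have h := p.tsum_coe
  rw [tsum_fintype] at h
  rw [← ENNReal.toReal_sum fun x _ => p.apply_ne_top x, h, ENNReal.toReal_one]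

theorem expect_bind (p : PMF α) (q : α → PMF β) (f : β → ℝ) :
    expect (p.bind q) f = expect p fun x => expect (q x) f := by
  simp only [expect, PMF.bind_apply, tsum_fintype, Finset.mul_sum]
  rw [Finset.sum_comm]
  refine Finset.sum_congr rfl fun y _ => ?_
  rw [ENNReal.toReal_sum fun x _ => ENNReal.mul_ne_top (p.apply_ne_top x) ((q x).apply_ne_top y),
    Finset.sum_mul]
  simp only [ENNReal.toReal_mul, mul_assoc]

theorem expect_pure (x : α) (f : α → ℝ) : expect (PMF.pure x) f = f x := by
  classical
  simp [expect, PMF.pure_apply, apply_ite ENNReal.toReal]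

theorem expect_map (p : PMF α) (g : α → β) (f : β → ℝ) :
    expect (p.map g) f = expect p fun x => f (g x) := by
  rw [← PMF.bind_pure_comp, expect_bind]
  simp only [Function.comp_apply, expect_pure]

theorem expect_uniform [Nonempty α] (f : α → ℝ) :
    expect (PMF.uniformOfFintype α) f = (Fintype.card α : ℝ)⁻¹ * ∑ x, f x := by
  simp [expect, PMF.uniformOfFintype_apply, Finset.mul_sum]

theorem expect_const (p : PMF α) (c : ℝ) : expect p (fun _ => c) = c := by
  rw [expect, ← Finset.sum_mul, sum_toReal, one_mul]

theorem expect_add (p : PMF α) (f g : α → ℝ) :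
    expect p (fun x => f x + g x) = expect p f + expect p g := by
  simp only [expect, mul_add, Finset.sum_add_distrib]

theorem expect_mul_left (p : PMF α) (c : ℝ) (f : α → ℝ) :
    expect p (fun x => c * f x) = c * expect p f := by
  simp only [expect, Finset.mul_sum, mul_left_comm]

theorem expect_le_expect (p : PMF α) {f g : α → ℝ} (h : ∀ x, p x ≠ 0 → f x ≤ g x) :
    expect p f ≤ expect p g := by
  refine Finset.sum_le_sum fun x _ => ?_
  by_cases hx : p x = 0
  · simp [hx]
  · exact mul_le_mul_of_nonneg_left (h x hx) ENNReal.toReal_nonneg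

theorem expect_eq_one_iff (p : PMF α) {f : α → ℝ} (hf : ∀ x, f x ≤ 1) :
    expect p f = 1 ↔ ∀ x, p x ≠ 0 → f x = 1 := by
  constructor
  · intro h
    have h1 : ∑ x, (p x).toReal * (1 - f x) = 0 := by
      simp only [mul_sub, mul_one, Finset.sum_sub_distrib, sum_toReal]
      rw [expect] at h; rw [h, sub_self]
    rw [Finset.sum_eq_zero_iff_of_nonneg fun x _ =>
      mul_nonneg ENNReal.toReal_nonneg (sub_nonneg.2 (hf x))] at h1
    intro x hx
    rcases mul_eq_zero.1 (h1 x (Finset.mem_univ _)) with h2 | h2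
    · exact absurd ((ENNReal.toReal_eq_zero_iff _).1 h2) (by simp [hx, p.apply_ne_top])
    · linarith
  · intro h
    have : expect p f = expect p fun _ => 1 :=
      le_antisymm (expect_le_expect p fun x hx => (h x hx).le)
        (expect_le_expect p fun x hx => (h x hx).ge)
    rw [this, expect_const]

end

/-! ## Winning probabilities -/

/-- The indicator function of winning. -/
def Game.win (G : Game) (x : G.X) (y : G.Y) (c : G.A × G.B) : ℝ :=
  if G.V x y c.1 c.2 then 1 else 0

namespace Strategy

variable {G : Game} {m n : ℕ}

/-- The winning probability on a given pair of questions. -/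
noncomputable def winProb (S : Strategy G m n) (x : G.X) (y : G.Y) : ℝ :=
  expect (S.corr x y) (G.win x y)

theorem corr_apply_toReal (S : Strategy G m n) (x : G.X) (y : G.Y) (c : G.A × G.B) :
    (S.corr x y c).toReal = S.prob x y c.1 c.2 := by
  rw [corr, PMF.ofFintype_apply, ENNReal.toReal_ofReal (S.prob_nonneg _ _ _ _)]

theorem winProb_eq (S : Strategy G m n) (x : G.X) (y : G.Y) :
    S.winProb x y = ∑ a, ∑ b, G.win x y (a, b) * S.prob x y a b := by
  rw [winProb, expect, Fintype.sum_prod_type]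
  simp only [corr_apply_toReal, mul_comm]

theorem winProb_le_one (S : Strategy G m n) (x : G.X) (y : G.Y) : S.winProb x y ≤ 1 := by
  rw [← expect_const (S.corr x y) 1]
  refine expect_le_expect _ fun c _ => ?_
  unfold Game.win
  split_ifs <;> norm_num

theorem value_eq_expect (S : Strategy G m n) :
    S.value = expect G.μ fun z => S.winProb z.1 z.2 := by
  rw [value, expect, Fintype.sum_prod_type]
  refine Finset.sum_congr rfl fun x _ => Finset.sum_congr rfl fun y _ => ?_
  simp only [winProb_eq, Finset.mul_sum, Game.win, mul_assoc]

theorem pvmA (S : Strategy G m n) (x : G.X) : IsPVM (S.MA x) := ⟨S.MA_proj x, S.MA_sum x⟩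

theorem pvmB (S : Strategy G m n) (y : G.Y) : IsPVM (S.MB y) := ⟨S.MB_proj y, S.MB_sum y⟩

end Strategy

section

variable {α β γ δ : Type*} [Fintype α] [Fintype β] [Fintype γ] [Fintype δ] [DecidableEq γ]
  [DecidableEq δ] {m n : ℕ}

theorem expVal_coarse_kronecker (ψ : Fin m × Fin n → ℂ) (M : α → Matrix (Fin m) (Fin m) ℂ)
    (N : β → Matrix (Fin n) (Fin n) ℂ) (g : α → γ) (h : β → δ) (c : γ) (d : δ) :
    expVal ψ (coarse g M c ⊗ₖ coarse h N d) =
      ∑ p, ∑ q, if g p = c ∧ h q = d then expVal ψ (M p ⊗ₖ N q) else 0 := by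
  rw [coarse, sum_kronecker, expVal_sum]
  refine Finset.sum_congr rfl fun p _ => ?_
  rw [coarse, kronecker_sum, expVal_sum]
  refine Finset.sum_congr rfl fun q _ => ?_
  by_cases h1 : g p = c <;> by_cases h2 : h q = d <;> simp [h1, h2, expVal]

theorem sum_mul_expVal_coarse (ψ : Fin m × Fin n → ℂ) (M : α → Matrix (Fin m) (Fin m) ℂ)
    (N : β → Matrix (Fin n) (Fin n) ℂ) (g : α → γ) (h : β → δ) (F : γ → δ → ℝ) :
    ∑ c, ∑ d, F c d * expVal ψ (coarse g M c ⊗ₖ coarse h N d) =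
      ∑ p, ∑ q, F (g p) (h q) * expVal ψ (M p ⊗ₖ N q) := by
  simp only [expVal_coarse_kronecker, Finset.mul_sum, mul_ite, mul_zero]
  have h1 : (∑ c, ∑ d, ∑ p, ∑ q, if g p = c ∧ h q = d then
      F c d * expVal ψ (M p ⊗ₖ N q) else 0) =
      ∑ z : γ × δ, ∑ r : α × β, if g r.1 = z.1 ∧ h r.2 = z.2 then
        F z.1 z.2 * expVal ψ (M r.1 ⊗ₖ N r.2) else 0 := by simp only [Fintype.sum_prod_type]
  rw [h1, Finset.sum_comm,
    ← Fintype.sum_prod_type' (f := fun p q => F (g p) (h q) * expVal ψ (M p ⊗ₖ N q))]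
  refine Finset.sum_congr rfl fun p _ => ?_
  rw [Finset.sum_eq_single (g p.1, h p.2)]
  · simp
  · rintro ⟨c, d⟩ _ hcd
    rw [if_neg]
    rintro ⟨rfl, rfl⟩
    exact hcd rfl
  · simp

end

/-! ## Soundness of the oracularized game -/

section

variable {G : Game} {m n : ℕ}

/-- The isolated answer of Alice, with a default value for answers of another form. -/
noncomputable def answerA (G : Game) : ORAnswer G → G.A
  | .inr (.inl a) => a
  | _ => Classical.arbitrary _

/-- The isolated answer of Bob, with a default value for answers of another form. -/
noncomputable def answerB (G : Game) : ORAnswer G → G.B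
  | .inr (.inr b) => b
  | _ => Classical.arbitrary _

/-- The oracle's answer, with a default value for answers of another form. -/
noncomputable def answerO (G : Game) : ORAnswer G → G.A × G.B
  | .inl c => c
  | _ => Classical.arbitrary _

/-- The strategy for `G` in which the players act on their questions as isolated players of the
oracularized game. -/
noncomputable def Strategy.isolated (S : Strategy G.oracularize m n) : Strategy G m n where
  ψ := S.ψ
  ψ_unit := S.ψ_unit
  MA x := coarse (answerA G) (S.MA (.inr (.inl x)))
  MB y := coarse (answerB G) (S.MB (.inr (.inr y)))
  MA_proj x := ((S.pvmA (.inr (.inl x))).coarse _).proj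
  MB_proj y := ((S.pvmB (.inr (.inr y))).coarse _).proj
  MA_sum x := ((S.pvmA (.inr (.inl x))).coarse _).sum_one
  MB_sum y := ((S.pvmB (.inr (.inr y))).coarse _).sum_one

theorem Strategy.nsq_ψ (S : Strategy G m n) : nsq S.ψ = 1 := by
  have h := S.ψ_unit
  rw [star_dotProduct_self] at h
  exact_mod_cast h

theorem expect_orDist (f : ORQuestion G × ORQuestion G → ℝ) :
    expect (orDist G) f = expect G.μ fun z => (10 : ℝ)⁻¹ * ∑ e : Fin 5,
      (f (roleQuestion G z (edges e).1, roleQuestion G z (edges e).2) +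
        f (roleQuestion G z (edges e).2, roleQuestion G z (edges e).1)) := by
  simp only [orDist, expect_bind, expect_map, expect_uniform]
  congr 1
  funext z
  simp only [Fintype.card_fin, Fintype.card_bool, Fintype.sum_bool, Finset.mul_sum]
  refine Finset.sum_congr rfl fun e _ => ?_
  simp
  ring

/-- The winning probability averaged over the edges of the type graph. -/
theorem Strategy.value_oracularize (S : Strategy G.oracularize m n) :
    S.value = expect G.μ fun z => (10 : ℝ)⁻¹ * ∑ e : Fin 5,
      (S.winProb (roleQuestion G z (edges e).1) (roleQuestion G z (edges e).2) +
        S.winProb (roleQuestion G z (edges e).2) (roleQuestion G z (edges e).1)) :=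
  S.value_eq_expect.trans (expect_orDist fun z => S.winProb z.1 z.2)

theorem Game.win_nonneg (x : G.X) (y : G.Y) (c : G.A × G.B) : 0 ≤ G.win x y c := by
  unfold Game.win; split_ifs <;> norm_num

theorem Game.win_le_one (x : G.X) (y : G.Y) (c : G.A × G.B) : G.win x y c ≤ 1 := by
  unfold Game.win; split_ifs <;> norm_num

/-- Only an inequality holds in the application: answers of the wrong form lose in the game, but
after being replaced by default values they may satisfy the test `F`. -/
theorem Strategy.winProb_le_of_coarse (S : Strategy G m n) {γ δ : Type*} [Fintype γ]
    [Fintype δ] [DecidableEq γ] [DecidableEq δ] (q : G.X) (r : G.Y) (g : G.A → γ)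
    (h : G.B → δ) (F : γ → δ → ℝ) (hF0 : ∀ c d, 0 ≤ F c d)
    (hF1 : ∀ c d, G.V q r c d = true → 1 ≤ F (g c) (h d)) :
    S.winProb q r ≤ ∑ c, ∑ d, F c d * expVal S.ψ (coarse g (S.MA q) c ⊗ₖ coarse h (S.MB r) d) := by
  rw [sum_mul_expVal_coarse, S.winProb_eq]
  refine Finset.sum_le_sum fun c _ => Finset.sum_le_sum fun d _ =>
    mul_le_mul_of_nonneg_right ?_ (S.prob_nonneg q r c d)
  unfold Game.win
  split_ifs with hV
  exacts [hF1 c d hV, hF0 _ _]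

/-- The operators named `A` and `O` act on the first tensor factor and `A'` and `B` on the second,
so the commutation needed for `expVal_ge_of_consistent` is automatic. -/
theorem Strategy.winProb_isolated (S : Strategy G.oracularize m n) (x : G.X) (y : G.Y) {δ : ℝ}
    (h1 : 1 - δ ≤ S.winProb (.inr (.inl x)) (.inr (.inl x)))
    (h2 : 1 - δ ≤ S.winProb (.inl (x, y)) (.inr (.inl x)))
    (h3 : 1 - δ ≤ S.winProb (.inl (x, y)) (.inr (.inr y))) {t : ℝ} (ht : 0 < t) :
    1 - δ * (21 + 20 / t) ≤ (1 + t) * S.isolated.winProb x y := by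
  have pA := ((S.pvmA (.inr (.inl x))).coarse (answerA G)).kronecker_one (m := Fin n)
  have pA' := ((S.pvmB (.inr (.inl x))).coarse (answerA G)).one_kronecker (m := Fin m)
  have pB := ((S.pvmB (.inr (.inr y))).coarse (answerB G)).one_kronecker (m := Fin m)
  have pO := ((S.pvmA (.inl (x, y))).coarse (answerO G)).kronecker_one (m := Fin n)
  have comm : ∀ (M : Matrix (Fin m) (Fin m) ℂ) (N : Matrix (Fin n) (Fin n) ℂ),
      M ⊗ₖ (1 : Matrix (Fin n) (Fin n) ℂ) * (1 : Matrix (Fin m) (Fin m) ℂ) ⊗ₖ N =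
        (1 : Matrix (Fin m) (Fin m) ℂ) ⊗ₖ N * M ⊗ₖ (1 : Matrix (Fin n) (Fin n) ℂ) := by
    intro M N
    simp only [← Matrix.mul_kronecker_mul, mul_one, one_mul]
  have key := expVal_ge_of_consistent pA pA' pB pO (fun _ _ => comm _ _) (fun _ _ => comm _ _)
    (fun _ _ => comm _ _) S.nsq_ψ (G.win x y) (Game.win_nonneg x y) (Game.win_le_one x y)
    (δ := δ) ?_ ?_ ?_ ht
  · refine key.trans (le_of_eq ?_)
    rw [S.isolated.winProb_eq, Fintype.sum_prod_type]
    simp only [← Matrix.mul_kronecker_mul, mul_one, one_mul]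
    rfl
  · refine h1.trans ((S.winProb_le_of_coarse _ _ (answerA G) (answerA G)
      (fun a a' => if a = a' then 1 else 0) ?_ ?_).trans (le_of_eq ?_))
    · intro c d
      split_ifs
      exacts [zero_le_one, le_rfl]
    · intro c d hV
      change orPred G _ _ c d = true at hV
      rcases c with c | c | c <;> rcases d with d | d | d <;>
        simp_all [orPred, answerA]
    · simp only [← Matrix.mul_kronecker_mul, mul_one, one_mul, ite_mul, zero_mul,
        Finset.sum_ite_eq, Finset.mem_univ, if_true]
  · refine h2.trans ((S.winProb_le_of_coarse _ _ (answerO G) (answerA G)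
      (fun p a => if p.1 = a then G.win x y p else 0) ?_ ?_).trans (le_of_eq ?_))
    · intro c d
      split_ifs
      exacts [Game.win_nonneg _ _ _, le_rfl]
    · intro c d hV
      change orPred G _ _ c d = true at hV
      rcases c with c | c | c <;> rcases d with d | d | d <;>
        simp [orPred] at hV
      obtain ⟨hV, rfl⟩ := hV
      simp [answerO, answerA, Game.win, hV]
    · simp only [← Matrix.mul_kronecker_mul, mul_one, one_mul, ite_mul, zero_mul,
        Finset.sum_ite_eq, Finset.mem_univ, if_true]
  · refine h3.trans ((S.winProb_le_of_coarse _ _ (answerO G) (answerB G)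
      (fun p b => if p.2 = b then G.win x y p else 0) ?_ ?_).trans (le_of_eq ?_))
    · intro c d
      split_ifs
      exacts [Game.win_nonneg _ _ _, le_rfl]
    · intro c d hV
      change orPred G _ _ c d = true at hV
      rcases c with c | c | c <;> rcases d with d | d | d <;>
        simp [orPred] at hV
      obtain ⟨hV, rfl⟩ := hV
      simp [answerO, answerB, Game.win, hV]
    · simp only [← Matrix.mul_kronecker_mul, mul_one, one_mul, ite_mul, zero_mul,
        Finset.sum_ite_eq, Finset.mem_univ, if_true]

theorem Strategy.value_isolated (S : Strategy G.oracularize m n) {t : ℝ} (ht : 0 < t) :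
    1 - 10 * (1 - S.value) * (21 + 20 / t) ≤ (1 + t) * S.isolated.value := by
  have hc : 0 < 21 + 20 / t := by positivity
  rw [S.isolated.value_eq_expect, S.value_oracularize, ← expect_mul_left]
  set w : G.X × G.Y → ℝ := fun z => (10 : ℝ)⁻¹ * ∑ e : Fin 5,
      (S.winProb (roleQuestion G z (edges e).1) (roleQuestion G z (edges e).2) +
        S.winProb (roleQuestion G z (edges e).2) (roleQuestion G z (edges e).1))
  have h0 (z : G.X × G.Y) : w z = (10 : ℝ)⁻¹ * ∑ e : Fin 5,
      (S.winProb (roleQuestion G z (edges e).1) (roleQuestion G z (edges e).2) +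
        S.winProb (roleQuestion G z (edges e).2) (roleQuestion G z (edges e).1)) := rfl
  clear_value w
  -- The bound is affine in `w`, so it suffices to prove it for each pair of questions.
  have e1 : 1 - 10 * (1 - expect G.μ w) * (21 + 20 / t) =
      expect G.μ fun z => (1 - 10 * (21 + 20 / t)) + (10 * (21 + 20 / t)) * w z := by
    rw [expect_add, expect_const, expect_mul_left]; ring
  rw [e1]
  refine expect_le_expect _ fun z _ => ?_
  obtain ⟨x, y⟩ := z
  have h := h0 (x, y)
  simp only [Fin.sum_univ_five] at h
  have l := S.winProb_le_one
  have key := S.winProb_isolated x y (δ := 10 * (1 - w (x, y))) ?_ ?_ ?_ ht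
  · refine le_trans (le_of_eq ?_) key
    ring
  all_goals
    simp only [edges, roleQuestion, Matrix.cons_val] at h
    linarith [l (.inl (x, y)) (.inl (x, y)), l (.inr (.inl x)) (.inr (.inl x)),
      l (.inr (.inr y)) (.inr (.inr y)), l (.inl (x, y)) (.inr (.inl x)),
      l (.inr (.inl x)) (.inl (x, y)), l (.inl (x, y)) (.inr (.inr y)),
      l (.inr (.inr y)) (.inl (x, y))]

end

/-- Soundness of oracularization, with a constant that depends only on `s`. -/
theorem exists_soundness_oracularize (s : ℝ) (hs : s < 1) :
    ∃ s' : ℝ, 0 ≤ s' ∧ s' < 1 ∧ ∀ (P : Protocol) (L : Set Str), P.IsSound L s →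
      P.oracularize.IsSound L s' := by
  -- A negative `s` is replaced by `0`, so that `t ≤ 1` and hence `0 ≤ s'`.
  set r := max s 0 with hr
  have hr0 : 0 ≤ r := le_max_right _ _
  have hr1 : r < 1 := max_lt hs one_pos
  set t := 1 - r with ht
  have ht0 : 0 < t := by linarith
  have ht1 : t ≤ 1 := by linarith
  set K := 10 * (21 + 20 / t) with hK
  have hK1 : 210 ≤ K := by
    have : 0 < 20 / t := by positivity
    linarith
  refine ⟨1 - t ^ 2 / K, ?_, ?_, fun P L h w hw m n (S : Strategy (P.game w).oracularize m n) => ?_⟩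
  · rw [sub_nonneg, div_le_one (by linarith)]
    nlinarith
  · have : 0 < t ^ 2 / K := by positivity
    linarith
  · change S.value ≤ _
    have h1 := (h w hw m n (Strategy.isolated S)).trans (le_max_left s 0)
    have h2 := Strategy.value_isolated S ht0
    have h3 : (1 + t) * (Strategy.isolated S).value ≤ (1 + t) * r :=
      mul_le_mul_of_nonneg_left h1 (by linarith)
    have h4 : t ^ 2 / K ≤ 1 - S.value := by
      have h5 : (1 - S.value) * K = 10 * (1 - S.value) * (21 + 20 / t) := by rw [hK]; ring
      -- The reason for taking `t = 1 - r`: even after the loss of the factor `1 + t`, the bound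
      -- stays below `1` by `t ^ 2`.
      have h6 : (1 + t) * r = 1 - t ^ 2 := by rw [ht]; ring
      rw [div_le_iff₀ (by linarith), h5]
      linarith
    linarith

/-! ## Consistent operators -/

section

variable {m : ℕ} {α γ δ : Type*} [Fintype α] [DecidableEq γ] [DecidableEq δ]

/-- The operator `K` acts in the same way on both sides of `ψ`. -/
def Consistent (ψ : Fin m × Fin m → ℂ) (K : Matrix (Fin m) (Fin m) ℂ) : Prop :=
  (K ⊗ₖ (1 : Matrix (Fin m) (Fin m) ℂ)) *ᵥ ψ = ((1 : Matrix (Fin m) (Fin m) ℂ) ⊗ₖ K) *ᵥ ψ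

/-- Consistency lets an operator next to the state switch tensor factors. -/
theorem expVal_kronecker {ψ : Fin m × Fin m → ℂ} {L : Matrix (Fin m) (Fin m) ℂ}
    (hL : Consistent ψ L) (K : Matrix (Fin m) (Fin m) ℂ) :
    expVal ψ (K ⊗ₖ L) = expVal ψ ((K * L) ⊗ₖ (1 : Matrix (Fin m) (Fin m) ℂ)) := by
  have h1 : K ⊗ₖ L = (K ⊗ₖ (1 : Matrix (Fin m) (Fin m) ℂ)) *
      ((1 : Matrix (Fin m) (Fin m) ℂ) ⊗ₖ L) := by
    rw [← Matrix.mul_kronecker_mul, mul_one, one_mul]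
  have h2 : (K * L) ⊗ₖ (1 : Matrix (Fin m) (Fin m) ℂ) =
      (K ⊗ₖ (1 : Matrix (Fin m) (Fin m) ℂ)) * (L ⊗ₖ (1 : Matrix (Fin m) (Fin m) ℂ)) := by
    rw [← Matrix.mul_kronecker_mul, mul_one]
  rw [expVal, expVal, h1, h2, ← Matrix.mulVec_mulVec, ← Matrix.mulVec_mulVec, hL]

/-- Moving the factors across one at a time reverses their order, so commutation is needed to
restore it. -/
theorem Consistent.mul {ψ : Fin m × Fin m → ℂ} {K L : Matrix (Fin m) (Fin m) ℂ}
    (hK : Consistent ψ K) (hL : Consistent ψ L) (h : K * L = L * K) : Consistent ψ (K * L) := by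
  have h1 : (K * L) ⊗ₖ (1 : Matrix (Fin m) (Fin m) ℂ) =
      (K ⊗ₖ (1 : Matrix (Fin m) (Fin m) ℂ)) * (L ⊗ₖ (1 : Matrix (Fin m) (Fin m) ℂ)) := by
    rw [← Matrix.mul_kronecker_mul, mul_one]
  have h2 : (K ⊗ₖ (1 : Matrix (Fin m) (Fin m) ℂ)) * ((1 : Matrix (Fin m) (Fin m) ℂ) ⊗ₖ L) =
      ((1 : Matrix (Fin m) (Fin m) ℂ) ⊗ₖ L) * (K ⊗ₖ (1 : Matrix (Fin m) (Fin m) ℂ)) := by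
    simp only [← Matrix.mul_kronecker_mul, mul_one, one_mul]
  rw [Consistent, h1, ← Matrix.mulVec_mulVec, hL, Matrix.mulVec_mulVec, h2,
    ← Matrix.mulVec_mulVec, hK, Matrix.mulVec_mulVec, ← Matrix.mul_kronecker_mul, mul_one, h]

theorem Consistent.coarse {ψ : Fin m × Fin m → ℂ} {M : α → Matrix (Fin m) (Fin m) ℂ}
    (hM : ∀ a, Consistent ψ (M a)) (g : α → γ) (c : γ) : Consistent ψ (coarse g M c) := by
  rw [Consistent, ZKOR.coarse, sum_kronecker, kronecker_sum, Matrix.sum_mulVec, Matrix.sum_mulVec]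
  refine Finset.sum_congr rfl fun p _ => ?_
  split_ifs
  · exact hM p
  · simp

theorem IsPVM.coarse_mul_coarse {M : α → Matrix (Fin m) (Fin m) ℂ} (hM : IsPVM M) (g : α → γ)
    (h : α → δ) (c : γ) (d : δ) :
    ZKOR.coarse g M c * ZKOR.coarse h M d = ∑ p, if g p = c ∧ h p = d then M p else 0 := by
  classical
  rw [ZKOR.coarse, ZKOR.coarse, Finset.sum_mul]
  refine Finset.sum_congr rfl fun p _ => ?_
  rw [Finset.mul_sum, Finset.sum_eq_single p]
  · by_cases h1 : g p = c <;> by_cases h2 : h p = d <;> simp [h1, h2, hM.mul_eq]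
  · intro q _ hq
    split_ifs <;> simp [hM.mul_eq, hq.symm]
  · simp

theorem IsPVM.coarse_comm {M : α → Matrix (Fin m) (Fin m) ℂ} (hM : IsPVM M) (g : α → γ)
    (h : α → δ) (c : γ) (d : δ) :
    ZKOR.coarse g M c * ZKOR.coarse h M d = ZKOR.coarse h M d * ZKOR.coarse g M c := by
  simp only [hM.coarse_mul_coarse, and_comm]

end

/-! ## Distributions of answers -/

theorem map_apply_toReal {α β : Type*} [Fintype α] [DecidableEq β] (p : PMF α) (g : α → β)
    (b : β) : (p.map g b).toReal = ∑ a, if g a = b then (p a).toReal else 0 := by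
  rw [PMF.map_apply, tsum_fintype, ENNReal.toReal_sum]
  · refine Finset.sum_congr rfl fun a _ => ?_
    by_cases h : g a = b
    · simp [h]
    · simp [h, Ne.symm h]
  · intro a _
    split_ifs
    exacts [p.apply_ne_top a, ENNReal.zero_ne_top]

theorem pmf_ext_toReal {α : Type*} {p q : PMF α} (h : ∀ a, (p a).toReal = (q a).toReal) :
    p = q :=
  PMF.ext fun a => (ENNReal.toReal_eq_toReal_iff' (p.apply_ne_top a) (q.apply_ne_top a)).1 (h a)

namespace Strategy

variable {G : Game} {m n : ℕ}

theorem corr_eq_map (S : Strategy G m n) (q : G.X) (r : G.Y) {γ : Type*} [Fintype γ] (p : PMF γ)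
    (g : γ → G.A) (h : γ → G.B) (hp : ∀ c d, S.prob q r c d =
      ∑ x, if g x = c ∧ h x = d then (p x).toReal else 0) :
    S.corr q r = p.map fun x => (g x, h x) := by
  refine pmf_ext_toReal fun c => ?_
  rw [corr_apply_toReal, hp, map_apply_toReal]
  simp only [Prod.ext_iff]

/-- No-signalling: Bob's operators sum to the identity, whatever his question is. -/
theorem corr_map_fst (S : Strategy G m n) (x : G.X) (y y' : G.Y) :
    (S.corr x y).map Prod.fst = (S.corr x y').map Prod.fst := by
  have key : ∀ y a, ((S.corr x y).map Prod.fst a).toReal =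
      expVal S.ψ (S.MA x a ⊗ₖ (1 : Matrix (Fin n) (Fin n) ℂ)) := by
    intro y a
    rw [map_apply_toReal, Fintype.sum_prod_type, Finset.sum_eq_single a,
      ← S.MB_sum y, kronecker_sum, expVal_sum]
    · simp only [if_true, corr_apply_toReal]
      rfl
    · simp +contextual
    · simp
  exact pmf_ext_toReal fun a => by rw [key, key]

theorem corr_map_snd (S : Strategy G m n) (x x' : G.X) (y : G.Y) :
    (S.corr x y).map Prod.snd = (S.corr x' y).map Prod.snd := by
  have key : ∀ x b, ((S.corr x y).map Prod.snd b).toReal =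
      expVal S.ψ ((1 : Matrix (Fin m) (Fin m) ℂ) ⊗ₖ S.MB y b) := by
    intro x b
    rw [map_apply_toReal, Fintype.sum_prod_type_right, Finset.sum_eq_single b,
      ← S.MA_sum x, sum_kronecker, expVal_sum]
    · simp only [if_true, corr_apply_toReal]
      rfl
    · simp +contextual
    · simp
  exact pmf_ext_toReal fun a => by rw [key, key]

end Strategy

/-! ## The honest strategy of the oracularized game -/

section

variable {G : Game} {m : ℕ}

/-- The answer of a player with a given role who knows the answers `(a, b)`. -/
def roleAnswer (G : Game) (c : G.A × G.B) : Role → ORAnswer G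
  | .oracle => .inl c
  | .alice => .inr (.inl c.1)
  | .bob => .inr (.inr c.2)

/-- The product of the measurements of both players. -/
noncomputable def Strategy.prodMeas (S : Strategy G m m) (z : G.X × G.Y) (c : G.A × G.B) :
    Matrix (Fin m) (Fin m) ℂ :=
  S.MA z.1 c.1 * S.MB z.2 c.2

open Classical in
/-- The oracle's measurement. On questions that are never asked, the operators of the two players
need not commute, and only Alice's measurement is performed. -/
noncomputable def Strategy.oracleMeas (S : Strategy G m m) (z : G.X × G.Y) :
    G.A × G.B → Matrix (Fin m) (Fin m) ℂ :=
  if G.μ z = 0 then coarse (fun a => (a, Classical.arbitrary G.B)) (S.MA z.1) else S.prodMeas z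

/-- The measurements of the honest players in the oracularized game. -/
noncomputable def Strategy.orMeas (S : Strategy G m m) :
    ORQuestion G → ORAnswer G → Matrix (Fin m) (Fin m) ℂ
  | .inl z => coarse Sum.inl (S.oracleMeas z)
  | .inr (.inl x) => coarse (fun a => .inr (.inl a)) (S.MA x)
  | .inr (.inr y) => coarse (fun b => .inr (.inr b)) (S.MB y)

namespace Strategy

variable {S : Strategy G m m}

theorem IsPCC.isPVM_prodMeas (hS : S.IsPCC) {z : G.X × G.Y} (hz : G.μ z ≠ 0) :
    IsPVM (S.prodMeas z) :=
  (S.pvmA z.1).mul (S.pvmB z.2) (hS.comm z.1 z.2 hz)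

theorem IsPCC.isPVM_orMeas (hS : S.IsPCC) (q : ORQuestion G) : IsPVM (S.orMeas q) := by
  rcases q with z | x | y
  · refine IsPVM.coarse ?_ _
    unfold oracleMeas
    split_ifs with hz
    · exact (S.pvmA z.1).coarse _
    · exact hS.isPVM_prodMeas hz
  · exact (S.pvmA x).coarse _
  · exact (S.pvmB y).coarse _

theorem IsPCC.consistent_prodMeas (hS : S.IsPCC) {z : G.X × G.Y} (hz : G.μ z ≠ 0)
    (c : G.A × G.B) : Consistent S.ψ (S.prodMeas z c) :=
  Consistent.mul (hS.consA _ _) (hS.consB _ _) (hS.comm z.1 z.2 hz _ _)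

theorem IsPCC.consistent_orMeas (hS : S.IsPCC) (q : ORQuestion G) (c : ORAnswer G) :
    Consistent S.ψ (S.orMeas q c) := by
  rcases q with z | x | y
  · refine Consistent.coarse (fun c => ?_) _ _
    unfold oracleMeas
    split_ifs with hz
    · exact Consistent.coarse (fun a => hS.consA _ a) _ _
    · exact hS.consistent_prodMeas hz c
  · exact Consistent.coarse (fun a => hS.consA _ a) _ _
  · exact Consistent.coarse (fun b => hS.consB _ b) _ _

theorem coarse_fst_prodMeas (S : Strategy G m m) (z : G.X × G.Y) :
    coarse Prod.fst (S.prodMeas z) = S.MA z.1 := by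
  funext a
  simp only [coarse_fst, prodMeas, ← Finset.mul_sum, S.MB_sum, mul_one]

theorem coarse_snd_prodMeas (S : Strategy G m m) (z : G.X × G.Y) :
    coarse Prod.snd (S.prodMeas z) = S.MB z.2 := by
  funext b
  simp only [coarse_snd, prodMeas, ← Finset.sum_mul, S.MA_sum, one_mul]

/-- The marginals of the product measurement are the players' own measurements. So every role
measures the same thing and reports a part of it; commutation and the joint distribution for all
pairs of roles follow at once. -/
theorem orMeas_roleQuestion (S : Strategy G m m) {z : G.X × G.Y} (hz : G.μ z ≠ 0) (r : Role) :
    S.orMeas (roleQuestion G z r) = coarse (fun c => roleAnswer G c r) (S.prodMeas z) := by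
  cases r
  · simp only [roleQuestion, orMeas, oracleMeas, if_neg hz]
    rfl
  · simp only [roleQuestion, orMeas]
    rw [← S.coarse_fst_prodMeas z, coarse_coarse]
    rfl
  · simp only [roleQuestion, orMeas]
    rw [← S.coarse_snd_prodMeas z, coarse_coarse]
    rfl

/-- The honest strategy of the oracularized game. -/
noncomputable def oracular (S : Strategy G m m) (hS : S.IsPCC) : Strategy G.oracularize m m where
  ψ := S.ψ
  ψ_unit := S.ψ_unit
  MA := S.orMeas
  MB := S.orMeas
  MA_proj q := (hS.isPVM_orMeas q).proj
  MB_proj q := (hS.isPVM_orMeas q).proj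
  MA_sum q := (hS.isPVM_orMeas q).sum_one
  MB_sum q := (hS.isPVM_orMeas q).sum_one

end Strategy

theorem exists_of_orDist_ne_zero {q r : ORQuestion G} (h : orDist G (q, r) ≠ 0) :
    ∃ z, G.μ z ≠ 0 ∧ ∃ e : Fin 5,
      (q = roleQuestion G z (edges e).1 ∧ r = roleQuestion G z (edges e).2) ∨
      (q = roleQuestion G z (edges e).2 ∧ r = roleQuestion G z (edges e).1) := by
  rw [← PMF.mem_support_iff, orDist, PMF.mem_support_bind_iff] at h
  obtain ⟨z, hz, h⟩ := h
  rw [PMF.mem_support_bind_iff] at h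
  obtain ⟨e, -, h⟩ := h
  rw [PMF.mem_support_map_iff] at h
  obtain ⟨b, -, h⟩ := h
  refine ⟨z, hz, e, ?_⟩
  cases b <;> simp at h
  exacts [.inl ⟨h.1.symm, h.2.symm⟩, .inr ⟨h.1.symm, h.2.symm⟩]

theorem orPred_roleAnswer (z : G.X × G.Y) (c : G.A × G.B) (h : G.V z.1 z.2 c.1 c.2 = true)
    (e : Fin 5) :
    orPred G (roleQuestion G z (edges e).1) (roleQuestion G z (edges e).2)
      (roleAnswer G c (edges e).1) (roleAnswer G c (edges e).2) = true ∧
    orPred G (roleQuestion G z (edges e).2) (roleQuestion G z (edges e).1)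
      (roleAnswer G c (edges e).2) (roleAnswer G c (edges e).1) = true := by
  fin_cases e <;> simp [edges, roleQuestion, roleAnswer, orPred, h]

namespace Strategy

variable {S : Strategy G m m}

/-- After consistency brings both operators to the first factor, their product is the sum of the
product measurement over the outcomes compatible with both reports. -/
theorem expVal_orMeas (hS : S.IsPCC) {z : G.X × G.Y} (hz : G.μ z ≠ 0) (r₁ r₂ : Role)
    (c d : ORAnswer G) :
    expVal S.ψ (S.orMeas (roleQuestion G z r₁) c ⊗ₖ S.orMeas (roleQuestion G z r₂) d) =
      ∑ p, if roleAnswer G p r₁ = c ∧ roleAnswer G p r₂ = d then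
        (S.corr z.1 z.2 p).toReal else 0 := by
  rw [expVal_kronecker (hS.consistent_orMeas _ _), S.orMeas_roleQuestion hz,
    S.orMeas_roleQuestion hz, (hS.isPVM_prodMeas hz).coarse_mul_coarse, sum_kronecker, expVal_sum]
  refine Finset.sum_congr rfl fun p _ => ?_
  by_cases h : roleAnswer G p r₁ = c ∧ roleAnswer G p r₂ = d
  · rw [if_pos h, if_pos h, corr_apply_toReal]
    -- Consistency is used backwards here: Bob's operator returns to the second factor, which gives
    -- the original correlation.
    exact (expVal_kronecker (hS.consB _ _) _).symm
  · rw [if_neg h, if_neg h]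
    simp [expVal]

theorem corr_oracular (hS : S.IsPCC) {z : G.X × G.Y} (hz : G.μ z ≠ 0) (r₁ r₂ : Role) :
    (S.oracular hS).corr (roleQuestion G z r₁) (roleQuestion G z r₂) =
      (S.corr z.1 z.2).map fun c => (roleAnswer G c r₁, roleAnswer G c r₂) :=
  corr_eq_map _ _ _ _ _ _ fun c d => expVal_orMeas hS hz r₁ r₂ c d

/-- Different pairs `z`, `z'` can produce the same questions only if both roles are Alice's or both
are Bob's, and then no-signalling applies. -/
theorem corr_map_roleAnswer (S : Strategy G m m) {z z' : G.X × G.Y} {r₁ r₂ : Role}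
    (h₁ : roleQuestion G z r₁ = roleQuestion G z' r₁)
    (h₂ : roleQuestion G z r₂ = roleQuestion G z' r₂) :
    ((S.corr z.1 z.2).map fun c => (roleAnswer G c r₁, roleAnswer G c r₂)) =
      (S.corr z'.1 z'.2).map fun c => (roleAnswer G c r₁, roleAnswer G c r₂) := by
  by_cases hz : z = z'
  · rw [hz]
  obtain ⟨x, y⟩ := z
  obtain ⟨x', y'⟩ := z'
  rcases r₁ with _ | _ | _ <;> rcases r₂ with _ | _ | _ <;> simp_all [roleQuestion]
  · have key := fun z : G.X × G.Y => PMF.map_comp Prod.fst (S.corr z.1 z.2)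
      fun a => ((.inr (.inl a), .inr (.inl a)) : ORAnswer G × ORAnswer G)
    exact (key (x', y)).symm.trans ((congrArg _ (S.corr_map_fst x' y y')).trans (key (x', y')))
  · have key := fun z : G.X × G.Y => PMF.map_comp Prod.snd (S.corr z.1 z.2)
      fun b => ((.inr (.inr b), .inr (.inr b)) : ORAnswer G × ORAnswer G)
    exact (key (x, y')).symm.trans ((congrArg _ (S.corr_map_snd x x' y')).trans (key (x', y')))

theorem isPCC_oracular (hS : S.IsPCC) : (S.oracular hS).IsPCC where
  comm q r h c d := by
    obtain ⟨z, hz, e, ⟨rfl, rfl⟩ | ⟨rfl, rfl⟩⟩ := exists_of_orDist_ne_zero h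
    all_goals
      change S.orMeas _ c * S.orMeas _ d = S.orMeas _ d * S.orMeas _ c
      rw [S.orMeas_roleQuestion hz, S.orMeas_roleQuestion hz]
      exact (hS.isPVM_prodMeas hz).coarse_comm _ _ _ _
  consA q c := hS.consistent_orMeas q c
  consB q c := hS.consistent_orMeas q c

theorem V_eq_true_of_value_eq_one {n : ℕ} {S : Strategy G m n} (h : S.value = 1) {z : G.X × G.Y}
    (hz : G.μ z ≠ 0) {c : G.A × G.B} (hc : S.corr z.1 z.2 c ≠ 0) :
    G.V z.1 z.2 c.1 c.2 = true := by
  rw [value_eq_expect, expect_eq_one_iff _ fun z => S.winProb_le_one _ _] at h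
  have h1 := (expect_eq_one_iff _ fun c => Game.win_le_one _ _ c).1 (h z hz) c hc
  by_contra h2
  simp [Game.win, h2] at h1

theorem value_oracular (hS : S.IsPCC) (h : S.value = 1) : (S.oracular hS).value = 1 := by
  rw [value_eq_expect, expect_eq_one_iff _ fun z => winProb_le_one _ _ _]
  rintro ⟨q, r⟩ hqr
  obtain ⟨z, hz, e, ⟨rfl, rfl⟩ | ⟨rfl, rfl⟩⟩ := exists_of_orDist_ne_zero hqr
  all_goals
    refine (expect_eq_one_iff _ fun c => Game.win_le_one _ _ c).2 fun c hc => ?_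
    rw [corr_oracular hS hz] at hc
    obtain ⟨c, hc', rfl⟩ := (PMF.mem_support_map_iff _ _ _).1 ((PMF.mem_support_iff _ _).2 hc)
    have hV := V_eq_true_of_value_eq_one h hz hc'
  · exact if_pos (orPred_roleAnswer z c hV e).1
  · exact if_pos (orPred_roleAnswer z c hV e).2

end Strategy

end

/-! ## Strings of the oracularized protocol -/

section

variable {α : Type} [Coded α]

/-- The string that a player with a given role sends or receives, given the pair of strings that
belong to both players of the original protocol. -/
def roleStr : Role → Str × Str → Str
  | .oracle, z => false :: pairStr z.1 z.2
  | .alice, z => true :: false :: z.1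
  | .bob, z => true :: true :: z.2

@[fun_prop]
theorem PolyTime.roleStr (r : Role) {f : α → Str × Str} (hf : PolyTime f) :
    PolyTime fun x => roleStr r (f x) := by
  cases r <;> unfold ZKOR.roleStr <;> fun_prop

/-- The string of a player whose role is the tag of the string `q`. -/
def tagStr (q : Str) (z : Str × Str) : Str :=
  bif q.headD false then
    bif q.tail.headD false then roleStr .bob z else roleStr .alice z
  else roleStr .oracle z

@[fun_prop]
theorem PolyTime.tagStr {q : α → Str} {f : α → Str × Str} (hq : PolyTime q) (hf : PolyTime f) :
    PolyTime fun x => tagStr (q x) (f x) := by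
  unfold ZKOR.tagStr
  fun_prop

@[simp]
theorem tagStr_roleStr (r : Role) (z c : Str × Str) : tagStr (roleStr r z) c = roleStr r c := by
  cases r <;> rfl

theorem pairStr_eq_iff {u v u' v' : Str} : pairStr u v = pairStr u' v' ↔ u = u' ∧ v = v' :=
  ⟨pairStr_inj, fun h => by rw [h.1, h.2]⟩

theorem sumStr_inl {U W : Type} (f : U ↪ Str) (g : W ↪ Str) (z : U × W) :
    sumStr f g (.inl z) = false :: pairStr (f z.1) (g z.2) := rfl

theorem sumStr_inr_inl {U W : Type} (f : U ↪ Str) (g : W ↪ Str) (u : U) :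
    sumStr f g (.inr (.inl u)) = true :: false :: f u := rfl

theorem sumStr_inr_inr {U W : Type} (f : U ↪ Str) (g : W ↪ Str) (v : W) :
    sumStr f g (.inr (.inr v)) = true :: true :: g v := rfl

theorem sumStr_roleQuestion {G : Game} (f : G.X ↪ Str) (g : G.Y ↪ Str) (z : G.X × G.Y)
    (r : Role) : sumStr f g (roleQuestion G z r) = roleStr r (f z.1, g z.2) := by
  cases r <;> rfl

theorem sumStr_roleAnswer {G : Game} (f : G.A ↪ Str) (g : G.B ↪ Str) (c : G.A × G.B)
    (r : Role) : sumStr f g (roleAnswer G c r) = roleStr r (f c.1, g c.2) := by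
  cases r <;> rfl

end

/-! ## Lengths -/

theorem length_sumStr_le {U W : Type} (f : U ↪ Str) (g : W ↪ Str) {k : ℕ}
    (hf : ∀ u, (f u).length ≤ k) (hg : ∀ v, (g v).length ≤ k) (c : (U × W) ⊕ U ⊕ W) :
    (sumStr f g c).length ≤ 3 * k + 2 := by
  rcases c with ⟨u, v⟩ | u | v
  · rw [sumStr_inl, List.length_cons, length_pairStr]
    have := hf u
    have := hg v
    simp only
    omega
  · have := hf u
    simp only [sumStr_inr_inl, List.length_cons]
    omega
  · have := hg v
    simp only [sumStr_inr_inr, List.length_cons]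
    omega

theorem Protocol.HasLengths.oracularize {P : Protocol} {q a : ℕ → ℕ} (h : P.HasLengths q a) :
    P.oracularize.HasLengths (fun n => 3 * q n + 2) (fun n => 3 * a n + 2) where
  lenX w := length_sumStr_le _ _ (h.lenX w) (h.lenY w)
  lenY w := length_sumStr_le _ _ (h.lenX w) (h.lenY w)
  lenA w := length_sumStr_le _ _ (h.lenA w) (h.lenB w)
  lenB w := length_sumStr_le _ _ (h.lenA w) (h.lenB w)

/-! ## Checking the form of answers -/

/-- Checks whether a string is an answer of the oracularized protocol. -/
def checkAnswer (f g : Str × Str → Bool) (z : Str × Str) : Bool :=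
  bif decide (roleStr .oracle (unpairStr z.2.tail) = z.2) then
    f (z.1, (unpairStr z.2.tail).1) && g (z.1, (unpairStr z.2.tail).2)
  else bif decide (roleStr .alice (z.2.tail.tail, []) = z.2) then f (z.1, z.2.tail.tail)
  else bif decide (roleStr .bob ([], z.2.tail.tail) = z.2) then g (z.1, z.2.tail.tail)
  else false

theorem polyTime_checkAnswer {f g : Str × Str → Bool} (hf : PolyTime f) (hg : PolyTime g) :
    PolyTime (checkAnswer f g) := by
  unfold checkAnswer
  fun_prop

/-- Each case decodes the string, encodes the result again and compares with the original, so the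
behaviour of the decoders on malformed strings is irrelevant. -/
theorem checkAnswer_iff {f g : Str × Str → Bool} {U W : Type} (i : U ↪ Str) (j : W ↪ Str) (w : Str)
    (hf : ∀ s, f (w, s) = true ↔ ∃ u, i u = s) (hg : ∀ s, g (w, s) = true ↔ ∃ v, j v = s)
    (s : Str) : checkAnswer f g (w, s) = true ↔ ∃ c, sumStr i j c = s := by
  constructor
  · intro h
    simp only [checkAnswer] at h
    by_cases h1 : roleStr .oracle (unpairStr s.tail) = s
    · simp only [h1, decide_true, cond_true, Bool.and_eq_true, hf, hg] at h
      obtain ⟨⟨u, hu⟩, v, hv⟩ := h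
      exact ⟨.inl (u, v), by rw [← h1, sumStr_inl, hu, hv]; rfl⟩
    by_cases h2 : roleStr .alice (s.tail.tail, []) = s
    · simp only [h1, h2, decide_true, decide_false, cond_true, cond_false, hf] at h
      obtain ⟨u, hu⟩ := h
      exact ⟨.inr (.inl u), by rw [← h2, sumStr_inr_inl, hu]; rfl⟩
    by_cases h3 : roleStr .bob ([], s.tail.tail) = s
    · simp only [h1, h2, h3, decide_true, decide_false, cond_true, cond_false, hg] at h
      obtain ⟨v, hv⟩ := h
      exact ⟨.inr (.inr v), by rw [← h3, sumStr_inr_inr, hv]; rfl⟩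
    · simp [h1, h2, h3] at h
  · rintro ⟨⟨u, v⟩ | u | v, rfl⟩
    · simp [checkAnswer, sumStr_inl, roleStr, (hf _).2 ⟨u, rfl⟩, (hg _).2 ⟨v, rfl⟩]
    · simp [checkAnswer, sumStr_inr_inl, roleStr, (hf _).2 ⟨u, rfl⟩]
    · simp [checkAnswer, sumStr_inr_inr, roleStr, (hg _).2 ⟨v, rfl⟩]

/-! ## Verification -/

/-- Verification of an oracle's answer `s` to the question `q`, and of the other player's answer
`s'` to the question `q'`. -/
def checkOracle (f : Str × Str × Str × Str × Str → Bool) (w q q' s s' : Str) : Bool :=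
  !(s.headD false) && f (w, (unpairStr q.tail).1, (unpairStr q.tail).2,
    (unpairStr s.tail).1, (unpairStr s.tail).2) && decide (tagStr q' (unpairStr s.tail) = s')

/-- The decision procedure of the oracularized protocol. -/
def checkWin (f : Str × Str × Str × Str × Str → Bool) (z : Str × Str × Str × Str × Str) : Bool :=
  bif !(z.2.1.headD false) then checkOracle f z.1 z.2.1 z.2.2.1 z.2.2.2.1 z.2.2.2.2
  else bif !(z.2.2.1.headD false) then checkOracle f z.1 z.2.2.1 z.2.1 z.2.2.2.2 z.2.2.2.1
  else (z.2.1.tail.headD false == z.2.2.1.tail.headD false) && z.2.2.2.1.headD false &&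
    (z.2.1.tail.headD false == z.2.2.2.1.tail.headD false) && decide (z.2.2.2.1 = z.2.2.2.2)

theorem polyTime_checkWin {f : Str × Str × Str × Str × Str → Bool} (hf : PolyTime f) :
    PolyTime (checkWin f) := by
  unfold checkWin checkOracle
  fun_prop

-- The oracle's answer determines the only acceptable answer of the other player; `tagStr` computes
-- it from the tag of the other question. The identity is checked on all 81 combinations of forms.
set_option maxHeartbeats 1000000 in
theorem checkWin_eq {G : Game} (eX : G.X ↪ Str) (eY : G.Y ↪ Str) (eA : G.A ↪ Str) (eB : G.B ↪ Str)
    {f : Str × Str × Str × Str × Str → Bool} (w : Str)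
    (hf : ∀ x y a b, f (w, eX x, eY y, eA a, eB b) = G.V x y a b) (q r : ORQuestion G)
    (c d : ORAnswer G) :
    checkWin f (w, sumStr eX eY q, sumStr eX eY r, sumStr eA eB c, sumStr eA eB d) =
      orPred G q r c d := by
  rcases q with ⟨x, y⟩ | x | y <;> rcases r with ⟨x', y'⟩ | x' | y' <;>
    rcases c with ⟨a, b⟩ | a | b <;> rcases d with ⟨a', b'⟩ | a' | b' <;>
    simp [checkWin, checkOracle, sumStr_inl, sumStr_inr_inl, sumStr_inr_inr, tagStr, roleStr,
      orPred, hf, pairStr_eq_iff, Bool.and_assoc, eq_comm]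

/-! ## Sampling -/

section

variable {α β γ δ : Type} [Coded α] [Coded β] [Coded γ] [Coded δ]

@[fun_prop]
theorem RandAlg.polyTime_run (M : RandAlg β γ) {g : α → β × List ℕ} (hg : PolyTime g) :
    PolyTime fun x => M.run (g x) := M.run_poly.comp hg

@[fun_prop]
theorem RandAlg.polyTime_sides (M : RandAlg β γ) {g : α → β} (hg : PolyTime g) :
    PolyTime fun x => M.sides (g x) := M.sides_poly.comp hg

/-- Deterministic preprocessing and postprocessing of a probabilistic algorithm. -/
def RandAlg.wrap (M : RandAlg β γ) (f : α → β) (g : α × γ → δ) (hf : PolyTime f)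
    (hg : PolyTime g) : RandAlg α δ where
  sides x := M.sides (f x)
  run z := g (z.1, M.run (f z.1, z.2))
  sides_poly := by fun_prop
  run_poly := by fun_prop

theorem RandAlg.dist_wrap (M : RandAlg β γ) (f : α → β) (g : α × γ → δ) (hf : PolyTime f)
    (hg : PolyTime g) (x : α) :
    (M.wrap f g hf hg).dist x = (M.dist (f x)).map fun c => g (x, c) := by
  rw [RandAlg.dist, RandAlg.dist, PMF.map_comp]
  rfl

theorem zeros_mem_support_dice (ks : List ℕ) :
    List.replicate ks.length 0 ∈ (dice ks).support := by
  induction ks with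
  | nil => simp [dice]
  | cons k ks ih =>
    rw [dice, PMF.mem_support_bind_iff]
    refine ⟨0, by simp, ?_⟩
    rw [PMF.mem_support_map_iff]
    exact ⟨_, ih, rfl⟩

/-- The output of a probabilistic algorithm when all dice show zero. -/
def RandAlg.zeroRun (M : RandAlg α β) (x : α) : β :=
  M.run (x, List.replicate (M.sides x).length 0)

@[fun_prop]
theorem RandAlg.polyTime_zeroRun (M : RandAlg β γ) {g : α → β} (hg : PolyTime g) :
    PolyTime fun x => M.zeroRun (g x) := by
  have h : PolyTime fun x => List.replicate (M.sides (g x)).length (0 : ℕ) := .zeros (by fun_prop)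
  unfold RandAlg.zeroRun
  fun_prop

/-- Zero is a face of every die. Applied to a sampler, this gives genuine questions in deterministic
polynomial time. -/
theorem RandAlg.zeroRun_mem_support (M : RandAlg α β) (x : α) :
    M.zeroRun x ∈ (M.dist x).support := by
  rw [RandAlg.dist, PMF.mem_support_map_iff]
  exact ⟨_, zeros_mem_support_dice _, rfl⟩

end

/-- The string for the first end of an edge of the type graph. -/
def endStr₁ (e : ℕ) (z : Str × Str) : Str :=
  -- Subtraction is truncated, so this test accepts both `0` and `1`.
  bif e - 1 == 0 then bif e == 0 then roleStr .oracle z else roleStr .alice z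
  else bif e - 1 - 1 == 0 then roleStr .bob z else roleStr .oracle z

/-- The string for the second end of an edge of the type graph. -/
def endStr₂ (e : ℕ) (z : Str × Str) : Str :=
  bif e == 0 then roleStr .oracle z
  else bif e - 1 == 0 then roleStr .alice z
  else bif e - 1 - 1 == 0 then roleStr .bob z
  else bif e - 1 - 1 - 1 == 0 then roleStr .alice z else roleStr .bob z

theorem endStr₁_eq (e : Fin 5) (z : Str × Str) : endStr₁ e z = roleStr (edges e).1 z := by
  fin_cases e <;> rfl

theorem endStr₂_eq (e : Fin 5) (z : Str × Str) : endStr₂ e z = roleStr (edges e).2 z := by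
  fin_cases e <;> rfl

/-- The strings for the ends of an edge, in an order that depends on the number `b`. -/
def edgeStr (e b : ℕ) (z : Str × Str) : Str × Str :=
  bif b == 0 then (endStr₁ e z, endStr₂ e z) else (endStr₂ e z, endStr₁ e z)

/-- The sampler of the oracularized protocol. -/
def RandAlg.oracularize (Q : RandAlg Str (Str × Str)) : RandAlg Str (Str × Str) where
  -- A die with entry `k` has `k + 1` faces: five for the edge, two for the order of its ends.
  sides w := 4 :: 1 :: Q.sides w
  run z := edgeStr (z.2.headD 0) (z.2.tail.headD 0) (Q.run (z.1, z.2.tail.tail))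
  sides_poly := by fun_prop
  run_poly := by
    unfold edgeStr endStr₁ endStr₂
    fun_prop

theorem map_uniform_fin_two {α : Type*} (f : Bool → α) :
    (PMF.uniformOfFintype Bool).map f =
      (PMF.uniformOfFintype (Fin (1 + 1))).map fun b => f (b == 1) := by
  have h : PMF.uniformOfFintype Bool =
      (PMF.uniformOfFintype (Fin (1 + 1))).map fun b => b == 1 := by
    refine pmf_ext_toReal fun b => ?_
    rw [map_apply_toReal]
    cases b <;> simp [Fin.sum_univ_two]
  rw [h, PMF.map_comp]
  rfl

/-- The algorithm rolls for the edge and the order before it draws the questions, whereas `orDist`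
draws the questions first; independent draws may be exchanged. -/
theorem RandAlg.dist_oracularize (Q : RandAlg Str (Str × Str)) (w : Str) {G : Game} (eX : G.X ↪ Str)
    (eY : G.Y ↪ Str) (hQ : Q.dist w = G.μ.map fun z => (eX z.1, eY z.2)) :
    Q.oracularize.dist w = (orDist G).map fun z => (sumStr eX eY z.1, sumStr eX eY z.2) := by
  have h1 : Q.oracularize.dist w = (PMF.uniformOfFintype (Fin 5)).bind fun e =>
      (PMF.uniformOfFintype (Fin (1 + 1))).bind fun b => (Q.dist w).map (edgeStr e b) := by
    simp only [RandAlg.dist, RandAlg.oracularize, dice, PMF.map_bind, PMF.map_comp]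
    rfl
  have h2 : ∀ (e : Fin 5) (z : G.X × G.Y),
      (PMF.uniformOfFintype (Fin (1 + 1))).map
        (fun b : Fin (1 + 1) => edgeStr e b (eX z.1, eY z.2)) =
      ((PMF.uniformOfFintype Bool).map fun swap =>
        if swap then (roleQuestion G z (edges e).2, roleQuestion G z (edges e).1)
        else (roleQuestion G z (edges e).1, roleQuestion G z (edges e).2)).map
          fun z => (sumStr eX eY z.1, sumStr eX eY z.2) := by
    intro e z
    rw [PMF.map_comp, map_uniform_fin_two]
    congr 1
    funext b
    fin_cases b <;> simp [edgeStr, endStr₁_eq, endStr₂_eq, sumStr_roleQuestion]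
  rw [h1, hQ, orDist]
  simp only [PMF.map_bind, ← h2]
  rw [PMF.bind_comm G.μ (PMF.uniformOfFintype (Fin 5))]
  congr 1
  funext e
  simp only [← PMF.bind_pure_comp, PMF.bind_bind, Function.comp_def, PMF.pure_bind]
  rw [PMF.bind_comm]

theorem Protocol.IsEfficient.oracularize {P : Protocol} (h : P.IsEfficient) :
    P.oracularize.IsEfficient where
  polyLengths := by
    obtain ⟨p, hp⟩ := h.polyLengths
    refine ⟨3 * p + 2, ?_⟩
    have := hp.oracularize
    simpa using this
  sampler := by
    obtain ⟨Q, hQ⟩ := h.sampler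
    exact ⟨Q.oracularize, fun w => Q.dist_oracularize w _ _ (hQ w)⟩
  answersA := by
    obtain ⟨f, hf, hf'⟩ := h.answersA
    obtain ⟨g, hg, hg'⟩ := h.answersB
    exact ⟨_, polyTime_checkAnswer hf hg, fun w s => checkAnswer_iff _ _ w (hf' w) (hg' w) s⟩
  answersB := by
    obtain ⟨f, hf, hf'⟩ := h.answersA
    obtain ⟨g, hg, hg'⟩ := h.answersB
    exact ⟨_, polyTime_checkAnswer hf hg, fun w s => checkAnswer_iff _ _ w (hf' w) (hg' w) s⟩
  verifier := by
    obtain ⟨f, hf, hf'⟩ := h.verifier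
    exact ⟨_, polyTime_checkWin hf, fun w => checkWin_eq _ _ _ _ w (hf' w)⟩

/-! ## Statistical distance -/

theorem summable_toReal {α : Type} (p : PMF α) : Summable fun x => (p x).toReal :=
  ENNReal.summable_toReal (by rw [p.tsum_coe]; exact ENNReal.one_ne_top)

theorem hasSum_map_toReal {α β : Type} (p : PMF α) (g : α → β) (b : β) :
    HasSum (fun x : g ⁻¹' {b} => (p x).toReal) (p.map g b).toReal := by
  have h : p.map g b = ∑' x : g ⁻¹' {b}, p x := by
    rw [PMF.map_apply, tsum_subtype]
    refine tsum_congr fun a => ?_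
    by_cases h : g a = b
    · simp [h]
    · simp [h, Ne.symm h]
  rw [h, ENNReal.tsum_toReal_eq fun x => p.apply_ne_top _]
  exact ((summable_toReal p).subtype _).hasSum

/-- Data processing: the sum is grouped along the fibres of `g`, with the triangle inequality on
each fibre. Strings form an infinite type, hence the summability arguments. -/
theorem statDist_map_le {α β : Type} (p q : PMF α) (g : α → β) :
    statDist (p.map g) (q.map g) ≤ statDist p q := by
  have hs : Summable fun x => |(p x).toReal - (q x).toReal| :=
    ((summable_toReal p).sub (summable_toReal q)).abs
  have hf : HasSum (fun b => ∑' x : g ⁻¹' {b}, |(p x).toReal - (q x).toReal|)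
      (∑' x, |(p x).toReal - (q x).toReal|) := by
    refine HasSum.sigma (γ := fun b => g ⁻¹' {b}) (f := fun x => |(p x.2).toReal - (q x.2).toReal|)
      ?_ fun b => (hs.subtype _).hasSum
    exact (Equiv.sigmaFiberEquiv g).hasSum_iff.2 hs.hasSum
  have hle : ∀ b, |(p.map g b).toReal - (q.map g b).toReal| ≤
      ∑' x : g ⁻¹' {b}, |(p x).toReal - (q x).toReal| := by
    intro b
    rw [← ((hasSum_map_toReal p g b).sub (hasSum_map_toReal q g b)).tsum_eq]
    simpa only [Real.norm_eq_abs] using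
      norm_tsum_le_tsum_norm (f := fun x : g ⁻¹' {b} => (p x).toReal - (q x).toReal)
        (hs.subtype (g ⁻¹' {b}))
  unfold statDist
  refine mul_le_mul_of_nonneg_left ?_ (by norm_num)
  rw [← hf.tsum_eq]
  exact Summable.tsum_le_tsum hle
    ((summable_toReal (p.map g)).sub (summable_toReal (q.map g))).abs hf.summable

/-! ## Zero knowledge of the oracularized protocol -/

/-- The distinguisher that prepares the questions and answers of players with given roles. -/
def roleDistinguisher (D : RandAlg (Str × Str × Str × Str × Str) Bool) (r₁ r₂ : Role) :
    RandAlg (Str × Str × Str × Str × Str) Bool :=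
  D.wrap (fun z => (z.1, roleStr r₁ (z.2.1, z.2.2.1), roleStr r₂ (z.2.1, z.2.2.1),
    roleStr r₁ z.2.2.2, roleStr r₂ z.2.2.2)) Prod.snd (by fun_prop) (by fun_prop)

/-- The formatting of questions and answers is absorbed into the distinguisher, which turns an
attack on the oracularized protocol into one on the original protocol. -/
theorem acceptProb_map (D : RandAlg (Str × Str × Str × Str × Str) Bool) (r₁ r₂ : Role)
    (w x y : Str) (p : PMF (Str × Str)) :
    acceptProb D w (roleStr r₁ (x, y)) (roleStr r₂ (x, y))
      (p.map fun c => (roleStr r₁ c, roleStr r₂ c)) =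
        acceptProb (roleDistinguisher D r₁ r₂) w x y p := by
  have h : ∀ c : Str × Str, (roleDistinguisher D r₁ r₂).dist (w, x, y, c.1, c.2) =
      D.dist (w, roleStr r₁ (x, y), roleStr r₂ (x, y), roleStr r₁ c, roleStr r₂ c) := fun c =>
    (RandAlg.dist_wrap _ _ _ _ _ _).trans (PMF.map_id _)
  rw [acceptProb, acceptProb, PMF.bind_map]
  simp only [Function.comp_def, h]

/-- The questions of the original protocol to which the answers are simulated: those contained in
the questions of the oracularized protocol, where a missing question is replaced by a question
that the sampler `Q` draws. -/
def baseQuestions (Q : RandAlg Str (Str × Str)) (z : Str × Str × Str) : Str × Str :=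
  bif !(z.2.1.headD false) then unpairStr z.2.1.tail
  else bif !(z.2.2.headD false) then unpairStr z.2.2.tail
  else bif z.2.1.tail.headD false then ((Q.zeroRun z.1).1, z.2.1.tail.tail)
  else (z.2.1.tail.tail, (Q.zeroRun z.1).2)

theorem polyTime_baseQuestions (Q : RandAlg Str (Str × Str)) : PolyTime (baseQuestions Q) := by
  unfold baseQuestions
  fun_prop

/-- The simulator of the oracularized protocol. -/
def RandAlg.orSimulator (Sim : RandAlg (Str × Str × Str) (Str × Str))
    (Q : RandAlg Str (Str × Str)) : RandAlg (Str × Str × Str) (Str × Str) :=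
  Sim.wrap (fun z => (z.1, baseQuestions Q z))
    (fun z => (tagStr z.1.2.1 z.2, tagStr z.1.2.2 z.2))
    (PolyTime.prodMk (by fun_prop) (polyTime_baseQuestions Q)) (by fun_prop)

/-- Here `z` is a pair that the verifier may have drawn and `z'` is the pair handed to the original
simulator. They yield the same questions for the roles at hand, but `z'` may have probability zero.
-/
theorem exists_baseQuestions {G : Game} (eX : G.X ↪ Str) (eY : G.Y ↪ Str)
    (Q : RandAlg Str (Str × Str)) (w : Str)
    (hQ : Q.dist w = G.μ.map fun z => (eX z.1, eY z.2)) {q r : ORQuestion G}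
    (h : orDist G (q, r) ≠ 0) :
    ∃ z, G.μ z ≠ 0 ∧ ∃ z' r₁ r₂, q = roleQuestion G z r₁ ∧ r = roleQuestion G z r₂ ∧
      q = roleQuestion G z' r₁ ∧ r = roleQuestion G z' r₂ ∧
      baseQuestions Q (w, sumStr eX eY q, sumStr eX eY r) = (eX z'.1, eY z'.2) := by
  obtain ⟨z₀, hz₀⟩ : ∃ z₀ : G.X × G.Y, (eX z₀.1, eY z₀.2) = Q.zeroRun w := by
    have := Q.zeroRun_mem_support w
    rw [hQ, PMF.mem_support_map_iff] at this
    obtain ⟨z₀, -, h⟩ := this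
    exact ⟨z₀, h⟩
  obtain ⟨z, hz, e, he⟩ := exists_of_orDist_ne_zero h
  -- An oracle question contains the whole pair, so in these cases `z' = z`.
  have hO : ∀ r₁ r₂, q = roleQuestion G z r₁ → r = roleQuestion G z r₂ →
      (r₁ = .oracle ∨ r₂ = .oracle) → ∃ z' r₁ r₂, q = roleQuestion G z r₁ ∧
        r = roleQuestion G z r₂ ∧ q = roleQuestion G z' r₁ ∧ r = roleQuestion G z' r₂ ∧
        baseQuestions Q (w, sumStr eX eY q, sumStr eX eY r) = (eX z'.1, eY z'.2) := by
    rintro r₁ r₂ rfl rfl hr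
    refine ⟨z, r₁, r₂, rfl, rfl, rfl, rfl, ?_⟩
    rw [sumStr_roleQuestion, sumStr_roleQuestion]
    rcases hr with rfl | rfl
    · simp [baseQuestions, roleStr]
    · cases r₁ <;> simp [baseQuestions, roleStr]
  refine ⟨z, hz, ?_⟩
  fin_cases e <;> simp only [edges, Fin.mk_one, Fin.zero_eta, Fin.reduceFinMk, Matrix.cons_val,
    or_self] at he
  · exact hO _ _ he.1 he.2 (.inl rfl)
  · refine ⟨(z.1, z₀.2), .alice, .alice, he.1, he.2, he.1, he.2, ?_⟩
    rw [he.1, he.2, sumStr_roleQuestion]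
    simp [baseQuestions, roleStr, ← hz₀]
  · refine ⟨(z₀.1, z.2), .bob, .bob, he.1, he.2, he.1, he.2, ?_⟩
    rw [he.1, he.2, sumStr_roleQuestion]
    simp [baseQuestions, roleStr, ← hz₀]
  all_goals
    rcases he with he | he
    · exact hO _ _ he.1 he.2 (by simp)
    · exact hO _ _ he.1 he.2 (by simp)

/-- The honest provers of the oracularized protocol. -/
noncomputable def Protocol.orProvers {P : Protocol} {L : Set Str} (S : P.Provers L)
    (hS : ∀ w hw, (S w hw).2.IsPCC) : P.oracularize.Provers L :=
  fun w hw => ⟨(S w hw).1, (S w hw).2.oracular (hS w hw)⟩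

/-- On questions that an honest verifier asks, the answers in the oracularized protocol and their
simulation arise in the same way from the answers in the original protocol and their
simulation. -/
theorem Protocol.exists_reduction {P : Protocol} {L : Set Str} (S : P.Provers L)
    (hS : ∀ w hw, (S w hw).2.IsPCC) (Q : RandAlg Str (Str × Str))
    (Sim : RandAlg (Str × Str × Str) (Str × Str)) (w : Str) (hw : w ∈ L)
    (hQ : Q.dist w = (P.game w).μ.map fun z => (P.encX w z.1, P.encY w z.2))
    (q : (P.oracularize.game w).X) (r : (P.oracularize.game w).Y)
    (h : (P.oracularize.game w).Asked .honest q r) :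
    ∃ x y r₁ r₂,
      P.oracularize.encX w q = roleStr r₁ (P.encX w x, P.encY w y) ∧
      P.oracularize.encY w r = roleStr r₂ (P.encX w x, P.encY w y) ∧
      P.oracularize.answers (orProvers S hS) w hw q r =
        (P.answers S w hw x y).map (fun c => (roleStr r₁ c, roleStr r₂ c)) ∧
      (Sim.orSimulator Q).dist (w, P.oracularize.encX w q, P.oracularize.encY w r) =
        (Sim.dist (w, P.encX w x, P.encY w y)).map (fun c => (roleStr r₁ c, roleStr r₂ c)) := by
  obtain ⟨z, hz, z', r₁, r₂, h1, h2, h3, h4, hb⟩ :=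
    exists_baseQuestions (P.encX w) (P.encY w) Q w hQ (q := q) (r := r) h
  have e1 : P.oracularize.encX w q = roleStr r₁ (P.encX w z'.1, P.encY w z'.2) := by
    rw [h3]; exact sumStr_roleQuestion _ _ _ _
  have e2 : P.oracularize.encY w r = roleStr r₂ (P.encX w z'.1, P.encY w z'.2) := by
    rw [h4]; exact sumStr_roleQuestion _ _ _ _
  refine ⟨z'.1, z'.2, r₁, r₂, e1, e2, ?_, ?_⟩
  -- The correlation is computed at `z`, which is asked, and then transferred to `z'` by
  -- no-signalling.
  · have h5 : ((S w hw).2.oracular (hS w hw)).corr q r = ((S w hw).2.corr z'.1 z'.2).map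
        fun c => (roleAnswer (P.game w) c r₁, roleAnswer (P.game w) c r₂) := by
      subst h1 h2
      exact (Strategy.corr_oracular (hS w hw) hz r₁ r₂).trans
        (Strategy.corr_map_roleAnswer _ h3 h4)
    change (((S w hw).2.oracular (hS w hw)).corr q r).map _ = _
    rw [h5, answers, PMF.map_comp]
    refine (PMF.map_comp _ _ _).trans ?_
    congr 1
    funext c
    exact Prod.ext (sumStr_roleAnswer _ _ _ _) (sumStr_roleAnswer _ _ _ _)
  · rw [RandAlg.orSimulator, RandAlg.dist_wrap, e1, e2]
    have hb' : baseQuestions Q (w, roleStr r₁ (P.encX w z'.1, P.encY w z'.2),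
        roleStr r₂ (P.encX w z'.1, P.encY w z'.2)) = (P.encX w z'.1, P.encY w z'.2) := by
      rw [← e1, ← e2]; exact hb
    simp only [hb', tagStr_roleStr]

theorem Protocol.ZeroKnowledge.oracularize {P : Protocol} {L : Set Str} {S : P.Provers L}
    (hS : ∀ w hw, (S w hw).2.IsPCC) {Q : RandAlg Str (Str × Str)}
    (hQ : ∀ w, Q.dist w = (P.game w).μ.map fun z => (P.encX w z.1, P.encY w z.2)) {k : Flavour}
    (h : P.ZeroKnowledge L .dishonest S k) :
    P.oracularize.ZeroKnowledge L .honest (orProvers S hS) k := by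
  cases k with
  | perfect =>
    obtain ⟨Sim, h⟩ := h
    refine ⟨Sim.orSimulator Q, fun w hw q r hqr => ?_⟩
    obtain ⟨x, y, r₁, r₂, -, -, e3, e4⟩ := exists_reduction S hS Q Sim w hw (hQ w) q r hqr
    -- The pair `(x, y)` may lie outside the support of the question distribution; `trivial` is the
    -- permission granted to dishonest verifiers.
    rw [e3, e4, h w hw x y trivial]
  | statistical =>
    obtain ⟨Sim, h⟩ := h
    refine ⟨Sim.orSimulator Q, fun c => ?_⟩
    obtain ⟨N, hN⟩ := h c
    refine ⟨N, fun w hw q r hl hqr => ?_⟩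
    obtain ⟨x, y, r₁, r₂, -, -, e3, e4⟩ := exists_reduction S hS Q Sim w hw (hQ w) q r hqr
    rw [e3, e4]
    exact (statDist_map_le _ _ _).trans (hN w hw x y hl trivial)
  | computational =>
    obtain ⟨Sim, h⟩ := h
    refine ⟨Sim.orSimulator Q, fun D c => ?_⟩
    -- The distinguisher obtained by reduction depends on the roles, so the threshold must dominate
    -- those of all nine pairs of roles.
    choose N hN using fun r₁ r₂ => h (roleDistinguisher D r₁ r₂) c
    obtain ⟨N₀, hN₀⟩ : ∃ N₀, ∀ r₁ r₂, N r₁ r₂ ≤ N₀ := by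
      have hrow : ∀ r₁, ∃ n, ∀ r₂, N r₁ r₂ ≤ n := fun r₁ =>
        ⟨N r₁ .oracle + N r₁ .alice + N r₁ .bob, fun r₂ => by cases r₂ <;> omega⟩
      choose n hn using hrow
      exact ⟨n .oracle + n .alice + n .bob, fun r₁ r₂ => (hn r₁ r₂).trans (by cases r₁ <;> omega)⟩
    refine ⟨N₀, fun w hw q r hl hqr => ?_⟩
    obtain ⟨x, y, r₁, r₂, e1, e2, e3, e4⟩ := exists_reduction S hS Q Sim w hw (hQ w) q r hqr
    rw [e4, e3, e1, e2, acceptProb_map, acceptProb_map]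
    exact hN r₁ r₂ w hw x y ((hN₀ r₁ r₂).trans hl) trivial

end ZKOR

theorem proposition4p2 (s : ℝ) (hs : s < 1) :
    ∃ s' : ℝ, 0 ≤ s' ∧ s' < 1 ∧
      ∀ (k : ZKOR.Flavour) (L : Set ZKOR.Str) (P : ZKOR.Protocol) (q a : ℕ → ℕ),
        P.IsZKMIPStar L s q a k .dishonest →
          P.oracularize.IsZKMIPStar L s' (fun n => 3 * q n + 2) (fun n => 3 * a n + 2) k
            .honest := by
  obtain ⟨s', h0, h1, hs'⟩ := ZKOR.exists_soundness_oracularize s hs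
  refine ⟨s', h0, h1, fun k L P q a h => ?_⟩
  obtain ⟨S, hS, hzk⟩ := h.complete_zk
  obtain ⟨Q, hQ⟩ := h.efficient.sampler
  exact
    { lengths := h.lengths.oracularize
      efficient := h.efficient.oracularize
      sound := hs' P L h.sound
      complete_zk := ⟨ZKOR.Protocol.orProvers S fun w hw => (hS w hw).2,
        fun w hw => ⟨ZKOR.Strategy.value_oracular (hS w hw).2 (hS w hw).1,
          ZKOR.Strategy.isPCC_oracular (hS w hw).2⟩,
        hzk.oracularize _ hQ⟩ }
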